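/- The following is provable in the base theory $\mathbf{RCA}_0$ of second order arithmetic; equivalently, it holds in every (possibly nonstandard) model $(M,\mathcal S)$ of $\mathbf{RCA}_0$, where all sets, orders and functions are understood to be sets of the model, and finite sets and finite functions are coded by numbers. Definitions. Embeddings of linear orders are strictly increasing functions. A normal prae-dilator consists of: a functor $T$ from the category of natural numbers (the finite orders $n=\{0,\dots,n-1\}$ with the embeddings between them) to the category of linear orders, with $T(n)\subseteq\mathbb N$; a natural transformation $\operatorname{supp}:T\Rightarrow[\cdot]^{<\omega}$ into the finite subset functor such that each $\sigma\in T(n)$ lies in the image of $T(e)$, where $e$ is the increasing enumeration of $\operatorname{supp}_n(\sigma)$ by its cardinality; and a natural family of embeddings $\mu_n:n\to T(n)$ such that $\sigma<_{T(n)}\mu_n(m)\Leftrightarrow\operatorname{supp}_n(\sigma)\subseteq\{0,\dots,m-1\}$ for all $\sigma\in T(n)$ and $m<n$. For a linear order $X$ let $$D^T(X)=\{\langle a,\sigma\rangle \mid a\subseteq X\text{ finite},\ \sigma\in T(|a|),\ \operatorname{supp}_{|a|}(\sigma)=|a|\},$$ ordered by $\langle a_0,\sigma_0\rangle<\langle a_1,\sigma_1\rangle\Leftrightarrow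 T(|\iota_0|)(\sigma_0)<_{T(|a_0\cup a_1|)}T(|\iota_1|)(\sigma_1)$, where $|\iota_i|:|a_i|\to|a_0\cup a_1|$ corresponds to the inclusion $a_i\hookrightarrow a_0\cup a_1$ under the increasing enumerations. The composition of normal prae-dilators is given by $(T\circ S)(n)=D^T(S(n))$, $(T\circ S)(f)(\langle a,\sigma\rangle)=\langle S(f)[a],\sigma\rangle$, $\operatorname{supp}_n(\langle a,\sigma\rangle)=\bigcup_{\tau\in a}\operatorname{supp}^S_n(\tau)$ and $\mu^{T\circ S}_n(m)=\langle\{\mu^S_n(m)\},\mu^T_1(0)\rangle$. An upper derivative of $T$ consists of a normal prae-dilator $S$ and a natural transformation $\xi:T\circ S\Rightarrow S$ (each $\xi_n$ being an embedding) with $\xi_n\circ\mu^{T\circ S}_n=\mu^S_n$ for all $n$. Let $1+X$ be the order $X$ with a new minimum $\bot$, and let $F$ be given by $$F(X)=1+\sum_{x\in 1+X}(1+X)\restriction x=\{\bot\}\cup\{\langle x,y\rangle\in(1+X)^2\mid y<_{1+X}x\},$$ where $\bot$ is minimal and pairs are ordered lexicographically, with $F(h)(\bot)=\bot$, $F(h)(\langle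 x,y\rangle)=\langle h(x),(1+h)(y)\rangle$ (where $1+h$ extends $h$ by $\bot\mapsto\bot$), $\operatorname{supp}^F(\bot)=\emptyset$, $\operatorname{supp}^F(\langle x,y\rangle)=\{x,y\}\setminus\{\bot\}$ and $\mu^F(x)=\langle x,\bot\rangle$; restricted to the category of natural numbers, $F$ is a normal dilator. Theorem. Assume that $G$ and $\xi:F\circ G\Rightarrow G$ form an upper derivative of $F$. Then, for every linear order $X$, there is an order embedding of $2^X$ into $D^G(X)$, where $2^X$ is the set of finite strictly descending sequences $\langle x_1,\dots,x_n\rangle$ ($x_n<_X\dots<_Xx_1$) with entries in $X$, ordered lexicographically (a proper initial segment of a sequence being smaller than the sequence). -/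

import Mathlib

universe u

namespace SOA

/-! ### Models of second order arithmetic and the theory RCA0

A model consists of a first order part `M` (a structure for the language `0, 1, +, *, <`) and a
collection `S : Set (Set M)`, the range of the set variables. By the completeness theorem, a
statement is a theorem of RCA0 precisely if it holds in every model of RCA0 (in particular, `M` may
be nonstandard, and the existence of an object means its existence in `S`). -/

/-- Structures for the language of first order arithmetic. -/
class ArithStr (M : Type u) extends Zero M, One M, Add M, Mul M, LT M

section Theory

variable {M : Type u} [ArithStr M]

/-- Functions given by a numerical term, with parameters from `M`. -/
inductive IsTerm {n : ℕ} : ((Fin n → M) → M) → Prop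
  | const (a : M) : IsTerm (fun _ => a)
  | var (i : Fin n) : IsTerm (fun v => v i)
  | add {s t : (Fin n → M) → M} : IsTerm s → IsTerm t → IsTerm (fun v => s v + t v)
  | mul {s t : (Fin n → M) → M} : IsTerm s → IsTerm t → IsTerm (fun v => s v * t v)

/-- Relations given by a formula all of whose quantifiers are bounded number quantifiers, with
number parameters from `M` and set parameters from `S`. -/
inductive IsBounded (S : Set (Set M)) : {n : ℕ} → ((Fin n → M) → Prop) → Prop
  | eq {n : ℕ} {s t : (Fin n → M) → M} :
      IsTerm s → IsTerm t → IsBounded S (fun v => s v = t v)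
  | lt {n : ℕ} {s t : (Fin n → M) → M} :
      IsTerm s → IsTerm t → IsBounded S (fun v => s v < t v)
  | mem {n : ℕ} {t : (Fin n → M) → M} {X : Set M} :
      IsTerm t → X ∈ S → IsBounded S (fun v => t v ∈ X)
  | not {n : ℕ} {φ : (Fin n → M) → Prop} :
      IsBounded S φ → IsBounded S (fun v => ¬ φ v)
  | and {n : ℕ} {φ ψ : (Fin n → M) → Prop} :
      IsBounded S φ → IsBounded S ψ → IsBounded S (fun v => φ v ∧ ψ v)
  | or {n : ℕ} {φ ψ : (Fin n → M) → Prop} :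
      IsBounded S φ → IsBounded S ψ → IsBounded S (fun v => φ v ∨ ψ v)
  | bex {n : ℕ} {t : (Fin n → M) → M} {φ : (Fin (n + 1) → M) → Prop} :
      IsTerm t → IsBounded S φ →
        IsBounded S (fun v => ∃ x, x < t v ∧ φ (Matrix.vecCons x v))
  | ball {n : ℕ} {t : (Fin n → M) → M} {φ : (Fin (n + 1) → M) → Prop} :
      IsTerm t → IsBounded S φ →
        IsBounded S (fun v => ∀ x, x < t v → φ (Matrix.vecCons x v))

/-- `P` is defined by a `Σ⁰₁`-formula with parameters: one unbounded existential number quantifier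
in front of a bounded formula. -/
def IsSigma1 (S : Set (Set M)) (P : M → Prop) : Prop :=
  ∃ θ : (Fin 2 → M) → Prop, IsBounded S θ ∧ ∀ x, P x ↔ ∃ y, θ ![y, x]

/-- `(M, S)` is a model of RCA0: basic axioms, `Σ⁰₁`-induction, `Δ⁰₁`-comprehension. -/
structure IsModelRCA0 (S : Set (Set M)) : Prop where
  succ_ne_zero : ∀ a : M, a + 1 ≠ 0
  succ_inj : ∀ a b : M, a + 1 = b + 1 → a = b
  add_zero : ∀ a : M, a + 0 = a
  add_succ : ∀ a b : M, a + (b + 1) = (a + b) + 1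
  mul_zero : ∀ a : M, a * 0 = 0
  mul_succ : ∀ a b : M, a * (b + 1) = a * b + a
  not_lt_zero : ∀ a : M, ¬ a < 0
  lt_succ : ∀ a b : M, a < b + 1 ↔ a < b ∨ a = b
  induction : ∀ P : M → Prop, IsSigma1 S P →
    P 0 → (∀ a, P a → P (a + 1)) → ∀ a, P a
  comprehension : ∀ P : M → Prop, IsSigma1 S P → IsSigma1 S (fun x => ¬ P x) →
    {x | P x} ∈ S

end Theory

noncomputable section

variable {M : Type u} [ArithStr M]

/-! ### Coding pairs, finite sets and finite functions by numbers -/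

/-- Some element that satisfies `P`, if there is one. It is used below where such an element
exists and is unique. -/
def pick (P : M → Prop) : M := @Classical.epsilon M ⟨0⟩ P

/-- The code of the pair `⟨i, j⟩`. -/
def pair (i j : M) : M := (i + j) * (i + j) + i

/-- The first component of a coded pair. -/
def fst (p : M) : M := pick (fun i => ∃ j, p = pair i j)

/-- The second component of a coded pair. -/
def snd (p : M) : M := pick (fun j => ∃ i, p = pair i j)

/-- The predecessor of a nonzero number. -/
def pred (a : M) : M := pick (fun b => a = b + 1)

/-- The set described by the number `c = ⟨⟨k, m⟩, n⟩`: all `i < k` such that `m(i+1)+1` divides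
`n`. -/
def ext (c : M) : Set M :=
  {i | ∃ k m n, c = pair (pair k m) n ∧ i < k ∧ ∃ d, n = (m * (i + 1) + 1) * d}

/-- `c` is the code of a finite set, i.e. the least number that describes this set. Every finite
set (that is, every bounded set of the model) has exactly one code. -/
def IsFinCode (c : M) : Prop := ∀ b : M, b < c → ext b ≠ ext c

/-- The code of the finite set `A`. -/
def codeOf (A : Set M) : M := pick (fun c => IsFinCode c ∧ ext c = A)

/-- `f` codes (as a finite set of pairs) a function from `{0, …, n-1}` to `B`, i.e. a finite
sequence of length `n` with entries in `B`. -/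
def IsFun (f n : M) (B : Set M) : Prop :=
  IsFinCode f ∧
  (∀ p ∈ ext f, ∃ i x, i < n ∧ x ∈ B ∧ p = pair i x) ∧
  (∀ i, i < n → ∃! x, pair i x ∈ ext f)

/-- The value at `i` of the finite function with code `f`. -/
def ap (f i : M) : M := pick (fun x => pair i x ∈ ext f)

/-! ### Linear orders -/

/-- The data of an order: its field and its strict order relation. -/
structure OrdData (M : Type u) where
  carrier : Set M
  lt : M → M → Prop

/-- The given data form a (strict) linear order. -/
structure OrdData.IsLinear (A : OrdData M) : Prop where
  dom : ∀ x y, A.lt x y → x ∈ A.carrier ∧ y ∈ A.carrier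
  irrefl : ∀ x, ¬ A.lt x x
  trans : ∀ x y z, A.lt x y → A.lt y z → A.lt x z
  total : ∀ x y, x ∈ A.carrier → y ∈ A.carrier → A.lt x y ∨ x = y ∨ A.lt y x

/-- `A` is a linear order of the model: field and order relation are sets of the model. -/
structure IsLinOrd (S : Set (Set M)) (A : OrdData M) : Prop where
  linear : A.IsLinear
  carrier_mem : A.carrier ∈ S
  lt_mem : {p | ∃ x y, p = pair x y ∧ A.lt x y} ∈ S

/-- `h` restricts to a strictly increasing function from `A` to `B`, i.e. to a morphism in the
category of linear orders. -/
def IsIncr (A B : OrdData M) (h : M → M) : Prop :=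
  (∀ x, x ∈ A.carrier → h x ∈ B.carrier) ∧
  (∀ x y, x ∈ A.carrier → y ∈ A.carrier → A.lt x y → B.lt (h x) (h y))

/-- `h` (or rather its restriction to the field of `A`) is an order embedding of `A` into `B` that
belongs to the model. -/
def IsOrderEmbedding (S : Set (Set M)) (A B : OrdData M) (h : M → M) : Prop :=
  {p | ∃ x, x ∈ A.carrier ∧ p = pair x (h x)} ∈ S ∧
  (∀ x, x ∈ A.carrier → h x ∈ B.carrier) ∧
  (∀ x y, x ∈ A.carrier → y ∈ A.carrier → (A.lt x y ↔ B.lt (h x) (h y)))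

/-- The finite order `n = {0, …, n-1}`. -/
def natOrd (n : M) : OrdData M where
  carrier := {i | i < n}
  lt i j := i < j ∧ j < n

/-- `f` codes a strictly increasing function from `n = {0, …, n-1}` to `A`. For `A = natOrd m`
these are the morphisms from `n` to `m` in the category of natural numbers. -/
def IsEmb (f n : M) (A : OrdData M) : Prop :=
  IsFun f n A.carrier ∧
  ∀ i j x y, pair i x ∈ ext f → pair j y ∈ ext f → i < j → A.lt x y

/-- The finite subset of `A` with code `a` has cardinality `c`, and `e` codes its strictly
increasing enumeration `en_a : c → A`. -/
def IsEnum (A : OrdData M) (e c a : M) : Prop :=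
  IsEmb e c A ∧ ∀ x, x ∈ ext a ↔ ∃ i, pair i x ∈ ext e

/-! ### Normal prae-dilators -/

/-- The data of a normal prae-dilator `T`: the orders `T(n)`, the action `map n m f : T(n) → T(m)`
of (codes of) strictly increasing functions `f : n → m`, the (codes of the) supports
`supp n σ` of elements `σ` of `T(n)`, and the functions `mu n : n → T(n)`. Only the values on the
indicated domains are relevant. -/
structure DilData (M : Type u) where
  ord : M → OrdData M
  map : M → M → M → M → M
  supp : M → M → M
  mu : M → M → M

/-- `T` is a prae-dilator of the model. -/
structure IsPraeDilator (S : Set (Set M)) (T : DilData M) : Prop where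
  linear : ∀ n, (T.ord n).IsLinear
  map_incr : ∀ n m f, IsEmb f n (natOrd m) → IsIncr (T.ord n) (T.ord m) (T.map n m f)
  map_id : ∀ n f, IsEmb f n (natOrd n) → (∀ i, i < n → ap f i = i) →
    ∀ σ, σ ∈ (T.ord n).carrier → T.map n n f σ = σ
  map_comp : ∀ n m k f g h, IsEmb f n (natOrd m) → IsEmb g m (natOrd k) →
    IsEmb h n (natOrd k) → (∀ i, i < n → ap h i = ap g (ap f i)) →
    ∀ σ, σ ∈ (T.ord n).carrier → T.map n k h σ = T.map m k g (T.map n m f σ)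
  supp_code : ∀ n σ, σ ∈ (T.ord n).carrier →
    IsFinCode (T.supp n σ) ∧ ∀ i, i ∈ ext (T.supp n σ) → i < n
  supp_natural : ∀ n m f, IsEmb f n (natOrd m) → ∀ σ, σ ∈ (T.ord n).carrier →
    ext (T.supp m (T.map n m f σ)) = ap f '' ext (T.supp n σ)
  /-- The support condition: `σ` lies in the image of `T(e)`, where `e : c → n` enumerates the
  support of `σ`. -/
  supp_cond : ∀ n σ, σ ∈ (T.ord n).carrier →
    ∃ c e, IsEnum (natOrd n) e c (T.supp n σ) ∧
      ∃ τ, τ ∈ (T.ord c).carrier ∧ T.map c n e τ = σ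
  carrier_mem : {p | ∃ n σ, p = pair n σ ∧ σ ∈ (T.ord n).carrier} ∈ S
  lt_mem : {p | ∃ n σ τ, p = pair n (pair σ τ) ∧ (T.ord n).lt σ τ} ∈ S
  map_mem : {p | ∃ n m f σ, p = pair (pair (pair n m) f) (pair σ (T.map n m f σ)) ∧
    IsEmb f n (natOrd m) ∧ σ ∈ (T.ord n).carrier} ∈ S
  supp_mem : {p | ∃ n σ, p = pair n (pair σ (T.supp n σ)) ∧ σ ∈ (T.ord n).carrier} ∈ S

/-- `T` is a normal prae-dilator of the model. -/
structure IsNormalPraeDilator (S : Set (Set M)) (T : DilData M) : Prop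
    extends IsPraeDilator S T where
  mu_incr : ∀ n, IsIncr (natOrd n) (T.ord n) (T.mu n)
  mu_natural : ∀ n m f, IsEmb f n (natOrd m) → ∀ i, i < n →
    T.map n m f (T.mu n i) = T.mu m (ap f i)
  normal : ∀ n σ m, σ ∈ (T.ord n).carrier → m < n →
    ((T.ord n).lt σ (T.mu n m) ↔ ∀ i, i ∈ ext (T.supp n σ) → i < m)
  mu_mem : {p | ∃ n m, p = pair n (pair m (T.mu n m)) ∧ m < n} ∈ S

/-- The order `D^T(A)`. Its elements are the pairs `⟨a, σ⟩` of (the code of) a finite set `a ⊆ A`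
and an element `σ` of `T(|a|)` with full support `|a|`. To compare `⟨a₀, σ₀⟩` and `⟨a₁, σ₁⟩`, let
`e₀, e₁, e` enumerate `a₀, a₁, b = a₀ ∪ a₁` and let `fᵢ : |aᵢ| → |b|` be the function that
corresponds to the inclusion of `aᵢ` into `b`, i.e. `e ∘ fᵢ = eᵢ`; then compare the images of
`σ₀` and `σ₁` under `T(f₀)` and `T(f₁)`. -/
def D (T : DilData M) (A : OrdData M) : OrdData M where
  carrier := {p | ∃ a σ c e, p = pair a σ ∧ IsFinCode a ∧ ext a ⊆ A.carrier ∧ IsEnum A e c a ∧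
    σ ∈ (T.ord c).carrier ∧ ext (T.supp c σ) = {i | i < c}}
  lt p q := ∃ a₀ σ₀ c₀ e₀ a₁ σ₁ c₁ e₁ b c e f₀ f₁,
    (p = pair a₀ σ₀ ∧ IsFinCode a₀ ∧ ext a₀ ⊆ A.carrier ∧ IsEnum A e₀ c₀ a₀ ∧
      σ₀ ∈ (T.ord c₀).carrier ∧ ext (T.supp c₀ σ₀) = {i | i < c₀}) ∧
    (q = pair a₁ σ₁ ∧ IsFinCode a₁ ∧ ext a₁ ⊆ A.carrier ∧ IsEnum A e₁ c₁ a₁ ∧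
      σ₁ ∈ (T.ord c₁).carrier ∧ ext (T.supp c₁ σ₁) = {i | i < c₁}) ∧
    (IsFinCode b ∧ ext b = ext a₀ ∪ ext a₁ ∧ IsEnum A e c b) ∧
    (IsEmb f₀ c₀ (natOrd c) ∧ ∀ i, i < c₀ → ap e (ap f₀ i) = ap e₀ i) ∧
    (IsEmb f₁ c₁ (natOrd c) ∧ ∀ i, i < c₁ → ap e (ap f₁ i) = ap e₁ i) ∧
    (T.ord c).lt (T.map c₀ c f₀ σ₀) (T.map c₁ c f₁ σ₁)

/-- The composition `T ∘ R`: we have `(T ∘ R)(n) = D^T(R(n))`, a morphism `f` sends `⟨a, σ⟩` to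
`⟨R(f)[a], σ⟩`, the support of `⟨a, σ⟩` is the union of the supports of the elements of `a`, and
the functions `mu` are given by `m ↦ ⟨{μ^R_n(m)}, μ^T_1(0)⟩`. -/
def comp (T R : DilData M) : DilData M where
  ord n := D T (R.ord n)
  map n m f p := pair (codeOf (R.map n m f '' ext (fst p))) (snd p)
  supp n p := codeOf {i | ∃ τ, τ ∈ ext (fst p) ∧ i ∈ ext (R.supp n τ)}
  mu n m := pair (codeOf {R.mu n m}) (T.mu 1 0)

/-- `ξ` is a natural transformation `T ⇒ R` of the model, between functors from natural numbers
to linear orders. -/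
structure IsNatTrans (S : Set (Set M)) (T R : DilData M) (ξ : M → M → M) : Prop where
  incr : ∀ n, IsIncr (T.ord n) (R.ord n) (ξ n)
  natural : ∀ n m f, IsEmb f n (natOrd m) → ∀ σ, σ ∈ (T.ord n).carrier →
    ξ m (T.map n m f σ) = R.map n m f (ξ n σ)
  mem : {p | ∃ n σ, p = pair n (pair σ (ξ n σ)) ∧ σ ∈ (T.ord n).carrier} ∈ S

/-- `R` and `ξ : T ∘ R ⇒ R` form an upper derivative of `T`. -/
structure IsUpperDerivative (S : Set (Set M)) (T R : DilData M) (ξ : M → M → M) : Prop where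
  normal : IsNormalPraeDilator S R
  natTrans : IsNatTrans S (comp T R) R ξ
  mu : ∀ n m, m < n → ξ n ((comp T R).mu n m) = R.mu n m

/-! ### The normal dilator `F` -/

/-- The order `1 + A`, where the new minimum `⊥` is coded by `0` and `x ∈ A` by `x + 1`. -/
def onePlus (A : OrdData M) : OrdData M where
  carrier := {u | u = 0 ∨ ∃ x ∈ A.carrier, u = x + 1}
  lt u v := (u = 0 ∧ ∃ y ∈ A.carrier, v = y + 1) ∨
    ∃ x ∈ A.carrier, ∃ y ∈ A.carrier, u = x + 1 ∧ v = y + 1 ∧ A.lt x y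

open Classical in
/-- The function `1 + h`. -/
def onePlusMap (h : M → M) (u : M) : M := if u = 0 then 0 else h (pred u) + 1

/-- The order `F(A) = {⊥} ∪ {⟨x, y⟩ ∈ (1 + A)² | y < x}`, where `⊥` is coded by `0` and `⟨x, y⟩`
by `pair x y + 1`. -/
def FOrd (A : OrdData M) : OrdData M where
  carrier := {σ | σ = 0 ∨ ∃ x ∈ (onePlus A).carrier, ∃ y ∈ (onePlus A).carrier,
    (onePlus A).lt y x ∧ σ = pair x y + 1}
  lt σ τ :=
    (σ = 0 ∧ ∃ x ∈ (onePlus A).carrier, ∃ y ∈ (onePlus A).carrier,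
      (onePlus A).lt y x ∧ τ = pair x y + 1) ∨
    ∃ x₀ ∈ (onePlus A).carrier, ∃ y₀ ∈ (onePlus A).carrier,
    ∃ x₁ ∈ (onePlus A).carrier, ∃ y₁ ∈ (onePlus A).carrier,
      (onePlus A).lt y₀ x₀ ∧ σ = pair x₀ y₀ + 1 ∧
      (onePlus A).lt y₁ x₁ ∧ τ = pair x₁ y₁ + 1 ∧
      ((onePlus A).lt x₀ x₁ ∨ (x₀ = x₁ ∧ (onePlus A).lt y₀ y₁))

open Classical in
/-- `F(h)` maps `⊥` to `⊥` and `⟨x, y⟩` to `⟨h(x), (1 + h)(y)⟩`. -/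
def FMap (h : M → M) (σ : M) : M :=
  if σ = 0 then 0
  else pair (onePlusMap h (fst (pred σ))) (onePlusMap h (snd (pred σ))) + 1

/-- The support of `⊥` is empty; the support of `⟨x, y⟩` consists of those among `x` and `y` that
are different from `⊥`. -/
def FSupp (σ : M) : M :=
  codeOf {x | σ ≠ 0 ∧ (x + 1 = fst (pred σ) ∨ x + 1 = snd (pred σ))}

/-- The function `x ↦ ⟨x, ⊥⟩`. -/
def FMu (x : M) : M := pair (x + 1) 0 + 1

/-- The normal dilator `F`, restricted to the category of natural numbers. -/
def F : DilData M where
  ord n := FOrd (natOrd n)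
  map _ _ f := FMap (ap f)
  supp _ := FSupp
  mu _ := FMu

/-! ### The order `2^A` -/

/-- The order `2^A` of finite strictly descending sequences in `A`, ordered lexicographically (a
proper initial segment of a sequence is smaller than the sequence). -/
def twoPow (A : OrdData M) : OrdData M where
  carrier := {s | ∃ n, IsFun s n A.carrier ∧ ∀ i j, i < j → j < n → A.lt (ap s j) (ap s i)}
  lt s t := ∃ n m,
    (IsFun s n A.carrier ∧ ∀ i j, i < j → j < n → A.lt (ap s j) (ap s i)) ∧
    (IsFun t m A.carrier ∧ ∀ i j, i < j → j < m → A.lt (ap t j) (ap t i)) ∧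
    ((n < m ∧ ∀ i, i < n → ap s i = ap t i) ∨
      ∃ k, k < n ∧ k < m ∧ A.lt (ap s k) (ap t k) ∧ ∀ i, i < k → ap s i = ap t i)

end

end SOA

/-!
Write `⟨v, u⟩ ∈ F(G(n))` for the pair of elements `u < v` of `G(n)`, and `μ`, `ξ` for the data of
the upper derivative. A descending sequence `⟨x₁, …, xₙ⟩` in `X` is sent to the iterated pair
`ξ⟨μ(x₁), ξ⟨μ(x₂), … ξ⟨μ(xₙ), ξ(⊥)⟩ … ⟩⟩`. This is a legitimate expression because the value at
`⟨x₂, …, xₙ⟩` has its support below `x₁` and hence lies below `μ(x₁)`, by normality of `G`. As `F`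
orders pairs lexicographically, with `⊥` as least element, and as `ξ` and `μ` are strictly
increasing, the map is strictly increasing; since `2^X` is linear and the order of `D^G(X)` is
asymmetric, it is an order embedding.

To obtain the map as a set of the model, one avoids a recursion over `D^G(X)`. By naturality, the
value at a sequence of length `n` is `⟨a, J n⟩`, where `a` is the set of entries and `J n ∈ G(n)` is
the value at the sequence `⟨n-1, …, 0⟩` in the finite order `n`. The elements `J n` are given by
primitive recursion along the numbers of the model (`exists_isDescendingFamily`). That `J n` has
full support, as required for elements of `D^G(X)`, holds because `ξ`, being natural and injective,
does not decrease supports (`mem_supp_derivPair`). The comparison of `⟨a, J n⟩` and `⟨b, J m⟩` takes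
place in `G(c)` for the cardinality `c` of `a ∪ b`. There the images of `J n` and `J m` are the last
values of two sequences of iterated pairs (`IsDescendingFamily.exists_tower`), which are compared by
`Σ⁰₁`-induction, starting from the first position at which the sequences differ (`tower_lt`).

The remaining work consists in the development of `RCA₀` inside an arbitrary model: arithmetic,
closure properties of `Σ⁰₁`- and `Δ⁰₁`-definability, codes of bounded sets (via Gödel's
divisibility coding, `exists_ext_eq`), primitive recursion (`exists_recursion`), and the existence
and uniqueness of increasing enumerations of finite sets (`exists_isEnum`, `IsEnum.unique`).
-/

namespace SOA

variable {M : Type u} [ArithStr M]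

/-! ### Arithmetic in a model -/

/-- `M` is the nonnegative part of a discretely ordered commutative ring. This holds for the first
order part of any model of RCA0; it is a class of its own since the algebraic instances on `M`
cannot depend on the sets of the model. -/
class IsArith (M : Type u) [ArithStr M] : Prop where
  arith_add_comm : ∀ a b : M, a + b = b + a
  arith_add_assoc : ∀ a b c : M, a + b + c = a + (b + c)
  arith_add_zero : ∀ a : M, a + 0 = a
  arith_add_cancel : ∀ a b c : M, a + c = b + c → a = b
  arith_mul_comm : ∀ a b : M, a * b = b * a
  arith_mul_assoc : ∀ a b c : M, a * b * c = a * (b * c)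
  arith_mul_zero : ∀ a : M, a * 0 = 0
  arith_mul_one : ∀ a : M, a * 1 = a
  arith_mul_add : ∀ a b c : M, a * (b + c) = a * b + a * c
  add_one_ne_zero : ∀ a : M, a + 1 ≠ 0
  lt_iff_exists_add_one : ∀ a b : M, a < b ↔ ∃ c, b = a + (c + 1)
  trichotomy : ∀ a b : M, a < b ∨ a = b ∨ b < a
  zero_or_add_one : ∀ a : M, a = 0 ∨ ∃ b, a = b + 1

section

variable {S : Set (Set M)}

theorem IsModelRCA0.bounded_induction (hS : IsModelRCA0 S) (P : M → Prop)
    (hP : IsBounded S (fun v : Fin 2 → M => P (v 1))) (h0 : P 0)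
    (h1 : ∀ a, P a → P (a + 1)) (a : M) : P a :=
  hS.induction P ⟨_, hP, fun x => by simp⟩ h0 h1 a

open IsTerm in
theorem IsModelRCA0.isArith (hS : IsModelRCA0 S) : IsArith M := by
  have : Nonempty M := ⟨0⟩
  have az := hS.add_zero
  have as := hS.add_succ
  have mz := hS.mul_zero
  have ms := hS.mul_succ
  have add_assoc : ∀ a b c : M, a + b + c = a + (b + c) := fun a b c => by
    refine hS.bounded_induction (fun c => a + b + c = a + (b + c))
      (.eq (add (add (const _) (const _)) (var 1)) (add (const _) (add (const _) (var 1)))) ?_ ?_ c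
    · simp only [az]
    · intro c h; rw [as, h, as, as]
  have zero_add : ∀ a : M, 0 + a = a := by
    refine hS.bounded_induction _ (.eq (add (const _) (var 1)) (var 1)) (az 0) ?_
    intro c h; rw [as, h]
  have one_add : ∀ a : M, 1 + a = a + 1 := by
    refine hS.bounded_induction _ (.eq (add (const _) (var 1)) (add (var 1) (const _))) ?_ ?_
    · rw [az, zero_add]
    · intro c h; rw [as, h]
  have add_comm : ∀ a b : M, a + b = b + a := fun a => by
    refine hS.bounded_induction (fun b => a + b = b + a)
      (.eq (add (const _) (var 1)) (add (var 1) (const _))) ?_ ?_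
    · rw [az, zero_add]
    · intro b h; rw [as, h, add_assoc b 1 a, one_add, as]
  have add_cancel : ∀ a b c : M, a + c = b + c → a = b := fun a b c => by
    have := hS.bounded_induction (fun c => ¬ (a + c = b + c) ∨ a = b)
      (.or (.not (.eq (add (const _) (var 1)) (add (const _) (var 1))))
        (.eq (const _) (const _))) ?_ ?_ c
    · tauto
    · simp only [az]; tauto
    · intro c h
      rw [as, as]
      rcases h with h | h
      · exact Or.inl fun h' => h (hS.succ_inj _ _ h')
      · exact Or.inr h
  have mul_add : ∀ a b c : M, a * (b + c) = a * b + a * c := fun a b => by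
    refine hS.bounded_induction (fun c => a * (b + c) = a * b + a * c)
      (.eq (mul (const _) (add (const _) (var 1)))
        (add (mul (const _) (const _)) (mul (const _) (var 1)))) ?_ ?_
    · rw [az, mz, az]
    · intro c h; rw [as, ms, h, ms, add_assoc]
  have zero_mul : ∀ a : M, 0 * a = 0 := by
    refine hS.bounded_induction _ (.eq (mul (const _) (var 1)) (const _)) (mz 0) ?_
    intro c h; rw [ms, h, az]
  have succ_mul : ∀ a b : M, (a + 1) * b = a * b + b := fun a => by
    refine hS.bounded_induction (fun b => (a + 1) * b = a * b + b)
      (.eq (mul (const _) (var 1)) (add (mul (const _) (var 1)) (var 1))) ?_ ?_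
    · rw [mz, mz, az]
    · intro b h
      rw [ms, h, ms, add_assoc, add_assoc, ← add_assoc b a 1, add_comm b a, add_assoc a b 1]
  have mul_comm : ∀ a b : M, a * b = b * a := fun a => by
    refine hS.bounded_induction (fun b => a * b = b * a)
      (.eq (mul (const _) (var 1)) (mul (var 1) (const _))) ?_ ?_
    · rw [mz, zero_mul]
    · intro b h; rw [ms, h, succ_mul]
  have mul_assoc : ∀ a b c : M, a * b * c = a * (b * c) := fun a b => by
    refine hS.bounded_induction (fun c => a * b * c = a * (b * c))
      (.eq (mul (const _) (var 1)) (mul (const _) (mul (const _) (var 1)))) ?_ ?_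
    · rw [mz, mz, mz]
    · intro c h; rw [ms, h, ms, mul_add]
  have mul_one : ∀ a : M, a * 1 = a := fun a => by
    have := ms a 0
    rwa [zero_add, mz, zero_add] at this
  have zero_or_succ : ∀ a : M, a = 0 ∨ ∃ b, a = b + 1 := by
    intro a
    refine hS.induction (fun a => a = 0 ∨ ∃ b, a = b + 1)
      ⟨fun v => v 1 = 0 ∨ v 1 = v 0 + 1, .or (.eq (var 1) (const _))
        (.eq (var 1) (add (var 0) (const _))), fun x => ?_⟩ (Or.inl rfl)
        (fun a _ => Or.inr ⟨a, rfl⟩) a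
    simp [exists_or]
  have lt_add : ∀ a c : M, a < a + (c + 1) := fun a => by
    refine hS.bounded_induction (fun c => a < a + (c + 1))
      (.lt (const _) (add (const _) (add (var 1) (const _)))) ?_ ?_
    · rw [zero_add]; exact (hS.lt_succ _ _).2 (Or.inr rfl)
    · intro c h; rw [as]; exact (hS.lt_succ _ _).2 (Or.inl h)
  have lt_iff : ∀ a b : M, a < b ↔ ∃ c, b = a + (c + 1) := fun a b => by
    constructor
    · have := hS.induction (fun b => ¬ a < b ∨ ∃ c, b = a + (c + 1))
        ⟨fun v => ¬ a < v 1 ∨ v 1 = a + (v 0 + 1), .or (.not (.lt (const _) (var 1)))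
        (.eq (var 1) (add (const _) (add (var 0) (const _)))), fun x => by simp [exists_or]⟩
        (Or.inl (hS.not_lt_zero a)) (fun b h => ?_) b
      · tauto
      · rw [hS.lt_succ]
        rcases h with h | ⟨c, rfl⟩
        · by_cases e : a = b
          · subst e; exact Or.inr ⟨0, by rw [zero_add]⟩
          · left; tauto
        · exact Or.inr ⟨c + 1, by rw [as a (c + 1)]⟩
    · rintro ⟨c, rfl⟩; exact lt_add a c
  have tri : ∀ a b : M, a < b ∨ a = b ∨ b < a := fun a => by
    refine hS.bounded_induction (fun b => a < b ∨ a = b ∨ b < a)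
      (.or (.lt (const _) (var 1)) (.or (.eq (const _) (var 1)) (.lt (var 1) (const _)))) ?_ ?_
    · rcases zero_or_succ a with rfl | ⟨c, rfl⟩
      · tauto
      · right; right; rw [lt_iff]; exact ⟨c, by rw [zero_add]⟩
    · intro b h
      rw [hS.lt_succ]
      rcases h with h | h | h
      · tauto
      · tauto
      · obtain ⟨c, rfl⟩ := (lt_iff _ _).1 h
        rcases zero_or_succ c with rfl | ⟨d, rfl⟩
        · rw [zero_add]; tauto
        · right; right; rw [lt_iff]; exact ⟨d, by rw [add_assoc b 1, one_add, add_assoc]⟩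
  exact ⟨add_comm, add_assoc, az, add_cancel, mul_comm, mul_assoc, mz, mul_one, mul_add,
    hS.succ_ne_zero, lt_iff, tri, zero_or_succ⟩

end

open IsArith

section

variable [IsArith M]

instance : CommSemiring M where
  add_assoc := arith_add_assoc
  zero_add a := by rw [arith_add_comm, arith_add_zero]
  add_zero := arith_add_zero
  add_comm := arith_add_comm
  mul_assoc := arith_mul_assoc
  one_mul a := by rw [arith_mul_comm, arith_mul_one]
  mul_one := arith_mul_one
  mul_comm := arith_mul_comm
  left_distrib := arith_mul_add
  right_distrib a b c := by
    rw [arith_mul_comm, arith_mul_add, arith_mul_comm c a, arith_mul_comm c b]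
  zero_mul a := by rw [arith_mul_comm, arith_mul_zero]
  mul_zero := arith_mul_zero
  nsmul := nsmulRec

instance : IsRightCancelAdd M := ⟨fun a _ _ h => arith_add_cancel _ _ a h⟩

instance : IsCancelAdd M where
  add_left_cancel a b c h := arith_add_cancel b c a (by simpa only [arith_add_comm] using h)

open Classical in
noncomputable instance : LinearOrder M where
  le a b := a < b ∨ a = b
  le_refl a := Or.inr rfl
  le_trans a b c h h' := by
    rcases h with h | rfl
    · rcases h' with h' | rfl
      · obtain ⟨d, rfl⟩ := (lt_iff_exists_add_one _ _).1 h
        obtain ⟨e, rfl⟩ := (lt_iff_exists_add_one _ _).1 h'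
        exact Or.inl ((lt_iff_exists_add_one _ _).2 ⟨d + 1 + e, by ring⟩)
      · exact Or.inl h
    · exact h'
  lt_iff_le_not_ge a b := by
    constructor
    · refine fun h => ⟨Or.inl h, ?_⟩
      obtain ⟨d, rfl⟩ := (lt_iff_exists_add_one _ _).1 h
      rintro (h' | h')
      · obtain ⟨e, he⟩ := (lt_iff_exists_add_one _ _).1 h'
        have : a + 0 = a + (d + e + 1 + 1) := by rw [add_zero]; rw [he]; nth_rw 1 [he]; ring
        exact add_one_ne_zero _ (add_left_cancel this).symm
      · have : a + (d + 1) = a + 0 := by rw [add_zero, h']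
        exact add_one_ne_zero _ (add_left_cancel this)
    · rintro ⟨h | rfl, h'⟩
      · exact h
      · exact absurd (Or.inr rfl) h'
  le_antisymm a b h h' := by
    rcases h with h | rfl
    · rcases h' with h' | rfl
      · obtain ⟨d, rfl⟩ := (lt_iff_exists_add_one _ _).1 h
        obtain ⟨e, he⟩ := (lt_iff_exists_add_one _ _).1 h'
        have : a + 0 = a + (d + e + 1 + 1) := by rw [add_zero]; nth_rw 1 [he]; ring
        exact absurd (add_left_cancel this).symm (add_one_ne_zero _)
      · rfl
    · rfl
  le_total a b := by
    rcases trichotomy a b with h | h | h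
    · exact Or.inl (Or.inl h)
    · exact Or.inl (Or.inr h)
    · exact Or.inr (Or.inl h)
  toDecidableLE := Classical.decRel _

instance : CanonicallyOrderedAdd M where
  exists_add_of_le {a b} h := by
    rcases h with h | rfl
    · obtain ⟨d, rfl⟩ := (lt_iff_exists_add_one _ _).1 h
      exact ⟨_, rfl⟩
    · exact ⟨0, (add_zero _).symm⟩
  le_self_add _ b := by
    rcases zero_or_add_one b with rfl | ⟨c, rfl⟩
    · exact Or.inr (add_zero _).symm
    · exact Or.inl ((lt_iff_exists_add_one _ _).2 ⟨c, rfl⟩)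
  le_add_self _ b := by
    rcases zero_or_add_one b with rfl | ⟨c, rfl⟩
    · exact Or.inr (zero_add _).symm
    · exact Or.inl ((lt_iff_exists_add_one _ _).2 ⟨c, add_comm _ _⟩)

instance : IsOrderedCancelAddMonoid M where
  add_le_add_left _ _ h _ := by
    obtain ⟨d, rfl⟩ := exists_add_of_le h
    rw [add_right_comm]; exact le_self_add
  le_of_add_le_add_left _ _ _ h := by
    obtain ⟨d, hd⟩ := exists_add_of_le h
    rw [add_assoc] at hd
    rw [add_left_cancel hd]; exact le_self_add

instance : IsStrictOrderedRing M :=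
  { (inferInstance : IsOrderedCancelAddMonoid M) with
    zero_le_one := zero_le
    exists_pair_ne := ⟨0, 1, fun h => add_one_ne_zero (0 : M) (by rw [zero_add, ← h])⟩
    mul_lt_mul_of_pos_left := by
      intro a ha b _ h
      obtain ⟨d, rfl⟩ := (lt_iff_exists_add_one _ _).1 h
      obtain ⟨e, rfl⟩ := (lt_iff_exists_add_one _ _).1 ha
      exact (lt_iff_exists_add_one _ _).2 ⟨e * d + e + d, by ring⟩
    mul_lt_mul_of_pos_right := by
      intro a ha b _ h
      obtain ⟨d, rfl⟩ := (lt_iff_exists_add_one _ _).1 h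
      obtain ⟨e, rfl⟩ := (lt_iff_exists_add_one _ _).1 ha
      exact (lt_iff_exists_add_one _ _).2 ⟨e * d + e + d, by ring⟩ }

theorem lt_add_one_iff_le {a b : M} : a < b + 1 ↔ a ≤ b := by
  constructor
  · intro h
    obtain ⟨c, hc⟩ := (lt_iff_exists_add_one _ _).1 h
    rw [← add_assoc] at hc
    rw [add_right_cancel hc]; exact le_self_add
  · intro h
    exact lt_of_le_of_lt h ((lt_iff_exists_add_one _ _).2 ⟨0, by rw [zero_add]⟩)

theorem add_one_le_iff_lt {a b : M} : a + 1 ≤ b ↔ a < b := by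
  rw [← lt_add_one_iff_le, add_lt_add_iff_right]

end

/-! ### Definable predicates and functions -/

section Definability

variable {S : Set (Set M)} {m n : ℕ}

theorem IsTerm.comp {t : (Fin m → M) → M} (ht : IsTerm t) {g : (Fin n → M) → Fin m → M}
    (hg : ∀ i, IsTerm fun v => g v i) : IsTerm fun v => t (g v) := by
  induction ht with
  | const a => exact .const a
  | var i => exact hg i
  | add _ _ h₁ h₂ => exact .add h₁ h₂
  | mul _ _ h₁ h₂ => exact .mul h₁ h₂

theorem IsTerm.cons {g : (Fin n → M) → Fin m → M} (hg : ∀ i, IsTerm fun v => g v i)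
    (i : Fin (m + 1)) :
    IsTerm fun v : Fin (n + 1) → M => Matrix.vecCons (v 0) (g fun j => v j.succ) i := by
  refine Fin.cases ?_ (fun i => ?_) i
  · simpa using IsTerm.var 0
  · simpa using (hg i).comp (g := fun v j => v j.succ) fun j => .var j.succ

theorem IsBounded.comp {φ : (Fin m → M) → Prop} (hφ : IsBounded S φ) :
    ∀ {n : ℕ} {g : (Fin n → M) → Fin m → M}, (∀ i, IsTerm fun v => g v i) →
      IsBounded S fun v => φ (g v) := by
  induction hφ with
  | eq hs ht => exact fun hg => .eq (hs.comp hg) (ht.comp hg)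
  | lt hs ht => exact fun hg => .lt (hs.comp hg) (ht.comp hg)
  | mem ht hX => exact fun hg => .mem (ht.comp hg) hX
  | not _ ih => exact fun hg => .not (ih hg)
  | and _ _ ih₁ ih₂ => exact fun hg => .and (ih₁ hg) (ih₂ hg)
  | or _ _ ih₁ ih₂ => exact fun hg => .or (ih₁ hg) (ih₂ hg)
  | bex ht _ ih =>
    intro n g hg
    simpa using IsBounded.bex (ht.comp hg) (ih (IsTerm.cons hg))
  | ball ht _ ih =>
    intro n g hg
    simpa using IsBounded.ball (ht.comp hg) (ih (IsTerm.cons hg))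

theorem IsBounded.bex_lt {P : (Fin n → M) → M → Prop} (i : Fin n)
    (h : IsBounded S fun w : Fin (n + 1) → M => P (fun i => w i.succ) (w 0)) :
    IsBounded S fun v => ∃ x, x < v i ∧ P v x := by
  simpa using IsBounded.bex (.var i) h

theorem IsBounded.ball_lt {P : (Fin n → M) → M → Prop} (i : Fin n)
    (h : IsBounded S fun w : Fin (n + 1) → M => P (fun i => w i.succ) (w 0)) :
    IsBounded S fun v => ∀ x, x < v i → P v x := by
  simpa using IsBounded.ball (.var i) h

variable (S)

/-- `P` is defined by a `Σ⁰₁`-formula with parameters, in several variables. Formulas are treated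
as predicates on assignments `Fin n → M`, and definability is found by type class inference: a
quantifier over `x` turns a predicate on `v` into a predicate on assignments `w`, where `w 0` stands
for `x` and `fun i => w i.succ` for `v`. -/
class Sigma1 {n : ℕ} (P : (Fin n → M) → Prop) : Prop where
  out : ∃ θ : (Fin (n + 1) → M) → Prop, IsBounded S θ ∧ ∀ v, P v ↔ ∃ y, θ (Matrix.vecCons y v)

/-- `P` is defined by a `Δ⁰₁`-formula with parameters. -/
class Delta1 {n : ℕ} (P : (Fin n → M) → Prop) : Prop where
  pos : Sigma1 S P
  neg : Sigma1 S fun v => ¬ P v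

/-- `f` is a total function of the model: its graph is `Σ⁰₁`, and hence `Δ⁰₁`. -/
class Recursive {n : ℕ} (f : (Fin n → M) → M) : Prop where
  graph : Sigma1 S fun w : Fin (n + 1) → M => w 0 = f fun i => w i.succ

variable {S}

theorem Sigma1.congr {P Q : (Fin n → M) → Prop} (h : ∀ v, P v ↔ Q v) (hQ : Sigma1 S Q) :
    Sigma1 S P := by
  rwa [show P = Q from funext fun v => propext (h v)]

theorem Delta1.congr {P Q : (Fin n → M) → Prop} (h : ∀ v, P v ↔ Q v) (hQ : Delta1 S Q) :
    Delta1 S P := by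
  rwa [show P = Q from funext fun v => propext (h v)]

theorem Sigma1.of_bounded {P : (Fin n → M) → Prop} (h : IsBounded S P) : Sigma1 S P :=
  ⟨_, h.comp (g := fun v i => v i.succ) fun i => .var i.succ, fun v => by
    have : Nonempty M := ⟨0⟩
    simp⟩

theorem Delta1.of_bounded {P : (Fin n → M) → Prop} (h : IsBounded S P) : Delta1 S P :=
  ⟨.of_bounded h, .of_bounded h.not⟩

theorem Sigma1.isSigma1 {P : M → Prop} (h : Sigma1 S fun v : Fin 1 → M => P (v 0)) :
    IsSigma1 S P := by
  obtain ⟨θ, hθ, h⟩ := h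
  exact ⟨θ, hθ, fun x => h ![x]⟩

theorem Sigma1.subst_terms {P : (Fin m → M) → Prop} (h : Sigma1 S P) {g : (Fin n → M) → Fin m → M}
    (hg : ∀ i, IsTerm fun v => g v i) : Sigma1 S fun v => P (g v) := by
  obtain ⟨θ, hθ, h⟩ := h
  refine ⟨_, hθ.comp (IsTerm.cons hg), fun v => ?_⟩
  simp [h]

theorem Sigma1.rename {P : (Fin m → M) → Prop} (h : Sigma1 S P) (ρ : Fin m → Fin n) :
    Sigma1 S fun v => P fun i => v (ρ i) :=
  h.subst_terms fun i => .var (ρ i)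

instance Sigma1.or {P Q : (Fin n → M) → Prop} [hP : Sigma1 S P] [hQ : Sigma1 S Q] :
    Sigma1 S fun v => P v ∨ Q v := by
  obtain ⟨θ, hθ, h⟩ := hP
  obtain ⟨η, hη, h'⟩ := hQ
  exact ⟨_, hθ.or hη, fun v => by rw [h, h', exists_or]⟩

variable [IsArith M]

instance Sigma1.ex {P : (Fin n → M) → M → Prop}
    [h : Sigma1 S fun w : Fin (n + 1) → M => P (fun i => w i.succ) (w 0)] :
    Sigma1 S fun v => ∃ x, P v x := by
  obtain ⟨θ, hθ, h⟩ := h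
  refine ⟨fun w => ∃ x, x < w 0 ∧ ∃ y, y < w 0 ∧
    θ (Matrix.vecCons y (Matrix.vecCons x fun i => w i.succ)), ?_, fun v => ?_⟩
  · refine .bex_lt 0 (.bex_lt 1 (hθ.comp fun i => ?_))
    refine Fin.cases (.var 0) (fun i => Fin.cases (.var 1) (fun i => ?_) i) i
    exact IsTerm.var i.succ.succ.succ
  · have h' : ∀ x, P v x ↔ ∃ y, θ (Matrix.vecCons y (Matrix.vecCons x v)) := fun x => by
      simpa using h (Matrix.vecCons x v)
    simp only [h', Matrix.cons_val_zero, Matrix.cons_val_succ]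
    constructor
    · rintro ⟨x, y, h⟩
      refine ⟨x + y + 1, x, ?_, y, ?_, h⟩
      · exact lt_add_one_iff_le.2 le_self_add
      · exact lt_add_one_iff_le.2 le_add_self
    · rintro ⟨b, x, -, y, -, h⟩
      exact ⟨x, y, h⟩

instance Sigma1.and {P Q : (Fin n → M) → Prop} [hP : Sigma1 S P] [hQ : Sigma1 S Q] :
    Sigma1 S fun v => P v ∧ Q v := by
  obtain ⟨θ, hθ, h⟩ := hP
  obtain ⟨η, hη, h'⟩ := hQ
  have key : Sigma1 S fun v => ∃ x, ∃ y,
      θ (Matrix.vecCons x v) ∧ η (Matrix.vecCons y v) := by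
    refine @Sigma1.ex _ _ _ _ _ _ (@Sigma1.ex _ _ _ _ _ _ (.of_bounded (.and ?_ ?_)))
    · refine hθ.comp fun i => Fin.cases (.var 1) (fun i => ?_) i
      exact .var i.succ.succ
    · refine hη.comp fun i => Fin.cases (.var 0) (fun i => ?_) i
      exact .var i.succ.succ
  refine key.congr fun v => ?_
  rw [h, h']
  simp

instance (priority := 50) Delta1.sigma {P : (Fin n → M) → Prop} [h : Delta1 S P] : Sigma1 S P :=
  h.pos

theorem Sigma1.ball_var [hS : Fact (IsModelRCA0 S)] {P : (Fin n → M) → M → Prop}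
    (h : Sigma1 S fun w : Fin (n + 1) → M => P (fun i => w i.succ) (w 0)) :
    Sigma1 S fun w : Fin (n + 1) → M => ∀ x, x < w 0 → P (fun i => w i.succ) x := by
  obtain ⟨θ, hθ, h⟩ := h
  have h' : ∀ v x, P v x ↔ ∃ y, θ (Matrix.vecCons y (Matrix.vecCons x v)) := fun v x => by
    simpa using h (Matrix.vecCons x v)
  -- `Σ⁰₁`-collection: witnesses below `a` have a common bound
  have coll : ∀ v : Fin n → M, ∀ a, (∀ x, x < a → P v x) → ∃ b, ∀ x, x < a → ∃ y, y < b ∧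
      θ (Matrix.vecCons y (Matrix.vecCons x v)) := by
    intro v a ha
    have := hS.out.induction (fun c => a < c ∨ ∃ b, ∀ x, x < c → ∃ y, y < b ∧
      θ (Matrix.vecCons y (Matrix.vecCons x v))) ?_ ?_ ?_ a
    · exact this.resolve_left (lt_irrefl a)
    · refine Sigma1.isSigma1 (@Sigma1.or _ _ _ _ _ _ (.of_bounded (.lt (.const a) (.var 0)))
        (@Sigma1.ex _ _ _ _ _ _ (.of_bounded ?_)))
      refine .ball_lt 1 (.bex_lt 1 ?_)
      refine hθ.comp fun i => Fin.cases (.var 0) (fun i => Fin.cases (.var 1) (fun i => ?_) i) i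
      exact .const (v i)
    · exact Or.inr ⟨0, fun x hx => absurd hx (hS.out.not_lt_zero x)⟩
    · rintro c (hc | ⟨b, hb⟩)
      · exact Or.inl (hc.trans (lt_add_one c))
      · rcases lt_or_ge c a with hca | hca
        · right
          obtain ⟨y, hy⟩ := (h' v c).1 (ha c hca)
          refine ⟨b + (y + 1), fun x hx => ?_⟩
          rcases (lt_add_one_iff_le.1 hx).lt_or_eq with hx | rfl
          · obtain ⟨z, hz, hz'⟩ := hb x hx
            exact ⟨z, hz.trans_le le_self_add, hz'⟩
          · exact ⟨y, (lt_add_one y).trans_le le_add_self, hy⟩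
        · exact Or.inl (lt_add_one_iff_le.2 hca)
  have key : Sigma1 S fun w : Fin (n + 1) → M => ∃ b, ∀ x, x < w 0 → ∃ y, y < b ∧
      θ (Matrix.vecCons y (Matrix.vecCons x fun i => w i.succ)) := by
    refine @Sigma1.ex _ _ _ _ _ _ (.of_bounded (.ball_lt 1 (.bex_lt 1 ?_)))
    refine hθ.comp fun i => Fin.cases (.var 0) (fun i => Fin.cases (.var 1) (fun i => ?_) i) i
    exact .var i.succ.succ.succ.succ
  refine key.congr fun w => ⟨coll _ _, ?_⟩
  rintro ⟨b, hb⟩ x hx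
  obtain ⟨y, -, hy⟩ := hb x hx
  exact (h' _ _).2 ⟨y, hy⟩

instance Recursive.const (a : M) : Recursive S fun _ : Fin n → M => a :=
  ⟨.of_bounded (.eq (.var 0) (.const a))⟩

instance Recursive.var (i : Fin n) : Recursive S fun v : Fin n → M => v i :=
  ⟨.of_bounded (.eq (.var 0) (.var i.succ))⟩

instance (priority := 50) Recursive.rename {f : (Fin m → M) → M} [h : Recursive S f]
    (ρ : Fin m → Fin n) : Recursive S fun v => f fun i => v (ρ i) :=
  ⟨h.graph.subst_terms (g := fun v => Matrix.vecCons (v 0) fun i => v (ρ i).succ) fun i =>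
    Fin.cases (.var 0) (fun i => .var (ρ i).succ) i⟩

theorem Sigma1.subst {Q : (Fin n → M) → M → Prop} {t : (Fin n → M) → M} (ht : Recursive S t)
    (h : Sigma1 S fun w : Fin (n + 1) → M => Q (fun i => w i.succ) (w 0)) :
    Sigma1 S fun v => Q v (t v) := by
  have := ht.graph
  have : Sigma1 S fun v => ∃ x, x = t v ∧ Q v x := inferInstance
  exact this.congr fun v => by simp

theorem Delta1.subst {Q : (Fin n → M) → M → Prop} {t : (Fin n → M) → M} (ht : Recursive S t)
    (h : Delta1 S fun w : Fin (n + 1) → M => Q (fun i => w i.succ) (w 0)) :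
    Delta1 S fun v => Q v (t v) :=
  ⟨Sigma1.subst ht h.pos, Sigma1.subst (Q := fun v x => ¬ Q v x) ht h.neg⟩

theorem Delta1.subst₁ {Q : M → Prop} (h : Delta1 S fun w : Fin 1 → M => Q (w 0))
    {t : (Fin n → M) → M} (ht : Recursive S t) : Delta1 S fun v => Q (t v) :=
  Delta1.subst (Q := fun _ x => Q x) ht ⟨h.pos.rename fun _ => 0, h.neg.rename fun _ => 0⟩

/-- Substitution into a binary predicate. -/
theorem Delta1.subst₂ {Q : M → M → Prop} (h : Delta1 S fun w : Fin 2 → M => Q (w 0) (w 1))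
    {s t : (Fin n → M) → M} (hs : Recursive S s) (ht : Recursive S t) :
    Delta1 S fun v => Q (s v) (t v) := by
  refine Delta1.subst (Q := fun v x => Q x (t v)) hs ?_
  refine Delta1.subst (Q := fun v x => Q (v 0) x) (Recursive.rename (f := t) Fin.succ) ?_
  exact ⟨h.pos.rename ![1, 0], h.neg.rename ![1, 0]⟩

instance Delta1.eq {s t : (Fin n → M) → M} [hs : Recursive S s] [ht : Recursive S t] :
    Delta1 S fun v => s v = t v :=
  Delta1.subst₂ (.of_bounded (.eq (.var 0) (.var 1))) hs ht

instance Delta1.lt {s t : (Fin n → M) → M} [hs : Recursive S s] [ht : Recursive S t] :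
    Delta1 S fun v => s v < t v :=
  Delta1.subst₂ (.of_bounded (.lt (.var 0) (.var 1))) hs ht

instance Delta1.not {P : (Fin n → M) → Prop} [h : Delta1 S P] : Delta1 S fun v => ¬ P v :=
  ⟨h.neg, h.pos.congr fun _ => not_not⟩

instance Delta1.and {P Q : (Fin n → M) → Prop} [hP : Delta1 S P] [hQ : Delta1 S Q] :
    Delta1 S fun v => P v ∧ Q v := by
  have := hP.neg
  have := hQ.neg
  have : Sigma1 S fun v => ¬ P v ∨ ¬ Q v := inferInstance
  exact ⟨inferInstance, this.congr fun v => by tauto⟩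

instance Sigma1.imp {P Q : (Fin n → M) → Prop} [hP : Delta1 S P] [hQ : Sigma1 S Q] :
    Sigma1 S fun v => P v → Q v := by
  have : Sigma1 S fun v => ¬ P v ∨ Q v := inferInstance
  exact this.congr fun v => imp_iff_not_or

instance Delta1.or {P Q : (Fin n → M) → Prop} [hP : Delta1 S P] [hQ : Delta1 S Q] :
    Delta1 S fun v => P v ∨ Q v := by
  have : Delta1 S fun v => ¬ (¬ P v ∧ ¬ Q v) := inferInstance
  exact this.congr fun v => by tauto

instance Delta1.imp {P Q : (Fin n → M) → Prop} [hP : Delta1 S P] [hQ : Delta1 S Q] :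
    Delta1 S fun v => P v → Q v := by
  have : Delta1 S fun v => ¬ P v ∨ Q v := inferInstance
  exact this.congr fun v => by tauto

instance Delta1.iff {P Q : (Fin n → M) → Prop} [hP : Delta1 S P] [hQ : Delta1 S Q] :
    Delta1 S fun v => P v ↔ Q v := by
  have : Delta1 S fun v => (P v → Q v) ∧ (Q v → P v) := inferInstance
  exact this.congr fun v => by tauto

instance Delta1.ne {s t : (Fin n → M) → M} [hs : Recursive S s] [ht : Recursive S t] :
    Delta1 S fun v => s v ≠ t v :=
  Delta1.not

instance Delta1.le {s t : (Fin n → M) → M} [hs : Recursive S s] [ht : Recursive S t] :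
    Delta1 S fun v => s v ≤ t v := by
  have : Delta1 S fun v => ¬ t v < s v := inferInstance
  exact this.congr fun v => by simp

instance Recursive.add {s t : (Fin n → M) → M} [hs : Recursive S s] [ht : Recursive S t] :
    Recursive S fun v => s v + t v := by
  refine ⟨?_⟩
  have : Delta1 S fun w : Fin (n + 1) → M => w 0 = s (fun i => w i.succ) + t fun i => w i.succ := by
    refine Delta1.subst (Q := fun w x => w 0 = x + t fun i => w i.succ) inferInstance ?_
    refine Delta1.subst (Q := fun w x => w 1 = w 0 + x) inferInstance ?_
    exact .of_bounded (.eq (.var 2) (.add (.var 1) (.var 0)))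
  exact this.pos

instance Recursive.mul {s t : (Fin n → M) → M} [hs : Recursive S s] [ht : Recursive S t] :
    Recursive S fun v => s v * t v := by
  refine ⟨?_⟩
  have : Delta1 S fun w : Fin (n + 1) → M => w 0 = s (fun i => w i.succ) * t fun i => w i.succ := by
    refine Delta1.subst (Q := fun w x => w 0 = x * t fun i => w i.succ) inferInstance ?_
    refine Delta1.subst (Q := fun w x => w 1 = w 0 * x) inferInstance ?_
    exact .of_bounded (.eq (.var 2) (.mul (.var 1) (.var 0)))
  exact this.pos

variable [hS : Fact (IsModelRCA0 S)]

instance Sigma1.ball {P : (Fin n → M) → M → Prop} {t : (Fin n → M) → M} [ht : Recursive S t]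
    [h : Sigma1 S fun w : Fin (n + 1) → M => P (fun i => w i.succ) (w 0)] :
    Sigma1 S fun v => ∀ x, x < t v → P v x :=
  Sigma1.subst (Q := fun v y => ∀ x, x < y → P v x) ht (Sigma1.ball_var h)

instance Delta1.ball {P : (Fin n → M) → M → Prop} {t : (Fin n → M) → M} [ht : Recursive S t]
    [h : Delta1 S fun w : Fin (n + 1) → M => P (fun i => w i.succ) (w 0)] :
    Delta1 S fun v => ∀ x, x < t v → P v x := by
  have := h.neg
  have : Sigma1 S fun v => ∃ x, x < t v ∧ ¬ P v x := inferInstance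
  exact ⟨inferInstance, this.congr fun v => by simp⟩

instance Delta1.bex {P : (Fin n → M) → M → Prop} {t : (Fin n → M) → M} [ht : Recursive S t]
    [h : Delta1 S fun w : Fin (n + 1) → M => P (fun i => w i.succ) (w 0)] :
    Delta1 S fun v => ∃ x, x < t v ∧ P v x := by
  have : Delta1 S fun v => ¬ ∀ x, x < t v → ¬ P v x := inferInstance
  exact this.congr fun v => by simp

variable (S)

omit [IsArith M] in
theorem sigma_induction (P : M → Prop) [Sigma1 S fun v : Fin 1 → M => P (v 0)] (h0 : P 0)
    (h1 : ∀ a, P a → P (a + 1)) (a : M) : P a :=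
  hS.out.induction P (Sigma1.isSigma1 inferInstance) h0 h1 a

omit [IsArith M] in
theorem comprehension (P : M → Prop) [h : Delta1 S fun v : Fin 1 → M => P (v 0)] :
    {x | P x} ∈ S :=
  hS.out.comprehension P h.pos.isSigma1 h.neg.isSigma1

theorem exists_least (P : M → Prop) [Delta1 S fun v : Fin 1 → M => P (v 0)] (h : ∃ a, P a) :
    ∃ a, P a ∧ ∀ b, b < a → ¬ P b := by
  by_contra hc
  have : ∀ a, ∀ b, b < a → ¬ P b := by
    have : Delta1 S fun v : Fin 2 → M => P (v 0) := Delta1.subst₁ ‹_› inferInstance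
    refine sigma_induction S _ (fun b hb => absurd hb (hS.out.not_lt_zero b)) fun a ha b hb => ?_
    rcases (lt_add_one_iff_le.1 hb).lt_or_eq with hb | rfl
    · exact ha b hb
    · exact fun hP => hc ⟨b, hP, ha⟩
  obtain ⟨a, ha⟩ := h
  exact this (a + 1) a (lt_add_one a) ha

end Definability

/-! ### Pairs and codes of finite sets -/

section Codes

variable {S : Set (Set M)} {n : ℕ}

theorem pick_spec {P : M → Prop} (h : ∃ x, P x) : P (pick P) :=
  Classical.epsilon_spec_aux ⟨0⟩ P h

theorem pick_eq {P : M → Prop} {x : M} (hx : P x) (h : ∀ y, P y → y = x) : pick P = x :=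
  h _ (pick_spec ⟨x, hx⟩)

variable [IsArith M]

theorem le_pair_left (i j : M) : i ≤ pair i j := le_add_self

theorem le_mul_self' (a : M) : a ≤ a * a := by
  rcases IsArith.zero_or_add_one a with rfl | ⟨b, rfl⟩
  · simp
  · exact le_mul_of_one_le_left zero_le le_add_self

theorem le_pair_right (i j : M) : j ≤ pair i j :=
  (le_add_self.trans (le_mul_self' (i + j))).trans le_self_add

theorem pair_lt_pair_of_add_lt {i j i' j' : M} (h : i + j < i' + j') : pair i j < pair i' j' := by
  have h1 : (i + j + 1) * (i + j + 1) ≤ (i' + j') * (i' + j') :=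
    mul_le_mul' (add_one_le_iff_lt.2 h) (add_one_le_iff_lt.2 h)
  refine lt_of_lt_of_le ?_ (h1.trans le_self_add)
  rw [← add_one_le_iff_lt, pair]
  have : (i + j + 1) * (i + j + 1) = (i + j) * (i + j) + i + 1 + (i + j + j) := by ring
  rw [this]
  exact le_self_add

theorem pair_inj {i j i' j' : M} : pair i j = pair i' j' ↔ i = i' ∧ j = j' := by
  refine ⟨fun h => ?_, fun ⟨h, h'⟩ => by rw [h, h']⟩
  rcases lt_trichotomy (i + j) (i' + j') with h' | h' | h'
  · exact absurd h (pair_lt_pair_of_add_lt h').ne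
  · rw [pair, pair, h'] at h
    have := add_left_cancel h
    subst this
    exact ⟨rfl, add_left_cancel h'⟩
  · exact absurd h (pair_lt_pair_of_add_lt h').ne'

@[simp] theorem fst_pair (i j : M) : fst (pair i j) = i :=
  pick_eq ⟨j, rfl⟩ fun _ ⟨_, h⟩ => (pair_inj.1 h).1.symm

@[simp] theorem snd_pair (i j : M) : snd (pair i j) = j :=
  pick_eq ⟨i, rfl⟩ fun _ ⟨_, h⟩ => (pair_inj.1 h).2.symm

@[simp] theorem pred_add_one (a : M) : pred (a + 1) = a :=
  pick_eq rfl fun _ h => (add_right_cancel h).symm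

theorem pair_lt_pair {i j i' j' : M} (hi : i < i') (hj : j < j') : pair i j < pair i' j' :=
  pair_lt_pair_of_add_lt (add_lt_add hi hj)

instance Recursive.pair {f g : (Fin n → M) → M} [Recursive S f] [Recursive S g] :
    Recursive S fun v => pair (f v) (g v) := by
  unfold SOA.pair
  infer_instance

theorem mem_ext_pair {i k m n : M} :
    i ∈ ext (pair (pair k m) n) ↔ i < k ∧ m * (i + 1) + 1 ∣ n := by
  constructor
  · rintro ⟨k', m', n', h, hi, hd⟩
    obtain ⟨h1, rfl⟩ := pair_inj.1 h
    obtain ⟨rfl, rfl⟩ := pair_inj.1 h1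
    exact ⟨hi, hd⟩
  · rintro ⟨hi, hd⟩
    exact ⟨k, m, n, rfl, hi, hd⟩

theorem lt_of_mem_ext {i c : M} (h : i ∈ ext c) : i < c := by
  obtain ⟨k, m, n, rfl, hi, -⟩ := h
  exact hi.trans_le ((le_pair_left _ _).trans (le_pair_left _ _))

theorem lt_left_of_pair_mem_ext {i j c : M} (h : pair i j ∈ ext c) : i < c :=
  (le_pair_left _ _).trans_lt (lt_of_mem_ext h)

theorem lt_right_of_pair_mem_ext {i j c : M} (h : pair i j ∈ ext c) : j < c :=
  (le_pair_right _ _).trans_lt (lt_of_mem_ext h)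

theorem dvd_iff_bounded {a b : M} : a ∣ b ↔ ∃ d, d < b + 1 ∧ b = a * d := by
  constructor
  · rintro ⟨d, rfl⟩
    rcases IsArith.zero_or_add_one a with rfl | ⟨c, rfl⟩
    · exact ⟨0, by simp⟩
    · exact ⟨d, lt_add_one_iff_le.2 (le_mul_of_one_le_left zero_le le_add_self), rfl⟩
  · rintro ⟨d, -, h⟩
    exact ⟨d, h⟩

theorem mem_ext_iff_bounded {i c : M} : i ∈ ext c ↔ ∃ k, k < c + 1 ∧ ∃ m, m < c + 1 ∧
    ∃ n, n < c + 1 ∧ c = pair (pair k m) n ∧ i < k ∧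
      ∃ d, d < n + 1 ∧ n = (m * (i + 1) + 1) * d := by
  constructor
  · rintro ⟨k, m, n, rfl, hi, hd⟩
    refine ⟨k, ?_, m, ?_, n, ?_, rfl, hi, dvd_iff_bounded.1 hd⟩ <;> rw [lt_add_one_iff_le]
    · exact (le_pair_left _ _).trans (le_pair_left _ _)
    · exact (le_pair_right _ _).trans (le_pair_left _ _)
    · exact le_pair_right _ _
  · rintro ⟨k, -, m, -, n, -, h, hi, d, -, hd⟩
    exact ⟨k, m, n, h, hi, d, hd⟩

instance Delta1.mem_set {A : Set M} [h : Fact (A ∈ S)] {f : (Fin n → M) → M} [Recursive S f] :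
    Delta1 S fun v => f v ∈ A :=
  Delta1.subst₁ (.of_bounded (.mem (.var 0) h.out)) inferInstance

/-- Coprimality of the moduli `m * (i + 1) + 1` when `m` is divisible by the difference of the
indices. -/
theorem dvd_of_dvd_mul_of_lt {i j m n : M} (hij : i < j) (hm : ∀ d, i + d = j → d ∣ m) :
    (m * (i + 1) + 1 ∣ n * (m * (j + 1) + 1) → m * (i + 1) + 1 ∣ n) ∧
    (m * (j + 1) + 1 ∣ n * (m * (i + 1) + 1) → m * (j + 1) + 1 ∣ n) := by
  obtain ⟨d, rfl⟩ := exists_add_of_le hij.le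
  obtain ⟨q, rfl⟩ := hm d rfl
  -- dividing `(j + 1) * pᵢ - (i + 1) * pⱼ = j - i` into `m` yields explicit Bezout coefficients
  constructor
  · rintro ⟨e, he⟩
    have key : n + (d * q * (i + 1) + 1) * ((i + 1) * (i + d + 1) * q * n) =
        (d * q * (i + 1) + 1) * (n + (i + 1) * (i + 1) * q * e) := by
      have : (d * q * (i + 1) + 1) * (n + (i + 1) * (i + 1) * q * e) =
        (d * q * (i + 1) + 1) * n + (i + 1) * (i + 1) * q * ((d * q * (i + 1) + 1) * e) := by ring
      rw [this, ← he]; ring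
    obtain ⟨f, hf⟩ := exists_add_of_le (show (i + 1) * (i + d + 1) * q * n ≤
        n + (i + 1) * (i + 1) * q * e by
      refine le_of_mul_le_mul_left (a := d * q * (i + 1) + 1) ?_ (zero_le.trans_lt (lt_add_one _))
      rw [← key]; exact le_add_self)
    refine ⟨f, ?_⟩
    rw [hf, mul_add (d * q * _ + 1), add_comm] at key
    exact add_left_cancel key
  · rintro ⟨e, he⟩
    have key : n + (d * q * (i + d + 1) + 1) * ((i + d + 1) * (i + d + 1) * q * e) =
        (d * q * (i + d + 1) + 1) * (n + (i + d + 1) * (i + 1) * q * n) := by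
      have : (d * q * (i + d + 1) + 1) * ((i + d + 1) * (i + d + 1) * q * e) =
        (i + d + 1) * (i + d + 1) * q * ((d * q * (i + d + 1) + 1) * e) := by ring
      rw [this, ← he]; ring
    obtain ⟨f, hf⟩ := exists_add_of_le (show (i + d + 1) * (i + d + 1) * q * e ≤
        n + (i + d + 1) * (i + 1) * q * n by
      refine le_of_mul_le_mul_left (a := d * q * (i + d + 1) + 1) ?_
        (zero_le.trans_lt (lt_add_one _))
      rw [← key]; exact le_add_self)
    refine ⟨f, ?_⟩
    rw [hf, mul_add (d * q * _ + 1), add_comm] at key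
    exact add_left_cancel key

variable [hS : Fact (IsModelRCA0 S)]

instance Delta1.dvd {f g : (Fin n → M) → M} [Recursive S f] [Recursive S g] :
    Delta1 S fun v => f v ∣ g v := by
  simp only [dvd_iff_bounded]
  infer_instance

instance Delta1.mem_ext {f g : (Fin n → M) → M} [Recursive S f] [Recursive S g] :
    Delta1 S fun v => f v ∈ ext (g v) := by
  simp only [mem_ext_iff_bounded]
  infer_instance

variable (S)

include hS in
/-- There is a nonzero common multiple of `1, …, b`. -/
theorem exists_common_multiple (b : M) : ∃ m, m ≠ 0 ∧ ∀ d, d < b → d + 1 ∣ m := by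
  refine sigma_induction S (fun b => ∃ m, m ≠ 0 ∧ ∀ d, d < b → d + 1 ∣ m)
    ⟨1, one_ne_zero, fun d hd => absurd hd not_lt_zero⟩ ?_ b
  rintro b ⟨m, hm, h⟩
  refine ⟨m * (b + 1), mul_ne_zero hm (IsArith.add_one_ne_zero b), fun d hd => ?_⟩
  rcases (lt_add_one_iff_le.1 hd).lt_or_eq with hd | rfl
  · exact (h d hd).mul_right _
  · exact dvd_mul_left _ _

theorem exists_ext_eq {A : Set M} (hA : A ∈ S) {b : M} (hb : ∀ x ∈ A, x < b) :
    ∃ c, ext c = A := by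
  have : Fact (A ∈ S) := ⟨hA⟩
  obtain ⟨m, hm, hdvd⟩ := exists_common_multiple S b
  have hne : ∀ i j n, i < b → j < b → i ≠ j →
      m * (i + 1) + 1 ∣ n * (m * (j + 1) + 1) → m * (i + 1) + 1 ∣ n := by
    have aux : ∀ i j, j < b → i < j → ∀ d, i + d = j → d ∣ m := by
      rintro i j hj hij d rfl
      rcases IsArith.zero_or_add_one d with rfl | ⟨e, rfl⟩
      · simp at hij
      · refine hdvd e (lt_of_lt_of_le ?_ hj.le)
        exact (lt_add_one e).trans_le le_add_self
    intro i j n hi hj hij h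
    rcases lt_or_gt_of_ne hij with hij | hij
    · exact (dvd_of_dvd_mul_of_lt hij (aux i j hj hij)).1 h
    · exact (dvd_of_dvd_mul_of_lt hij (aux j i hi hij)).2 h
  have key : ∀ j, j ≤ b → ∃ n, ∀ i, i < b → (m * (i + 1) + 1 ∣ n ↔ i < j ∧ i ∈ A) := by
    refine fun j hj => (sigma_induction S (fun j => b < j ∨ ∃ n, ∀ i, i < b →
      (m * (i + 1) + 1 ∣ n ↔ i < j ∧ i ∈ A)) ?_ ?_ j).resolve_left hj.not_gt
    · refine Or.inr ⟨1, fun i _ => ⟨fun h => ?_, fun h => absurd h.1 not_lt_zero⟩⟩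
      have h1 : m * (i + 1) = 0 := by
        obtain ⟨d, hd⟩ := h
        rcases IsArith.zero_or_add_one d with rfl | ⟨e, rfl⟩
        · simp at hd
        · have : 0 + 1 = (m * (i + 1) + (m * (i + 1) + 1) * e) + 1 := by
            rw [zero_add]; exact hd.trans (by ring)
          exact (add_eq_zero.1 (add_right_cancel this).symm).1
      exact absurd h1 (mul_ne_zero hm (IsArith.add_one_ne_zero i))
    · intro j hj
      rcases lt_or_ge j b with hjb | hjb
      swap
      · exact Or.inl (lt_add_one_iff_le.2 hjb)
      obtain ⟨n, hn⟩ := hj.resolve_left hjb.not_gt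
      right
      by_cases hjA : j ∈ A
      · refine ⟨n * (m * (j + 1) + 1), fun i hi => ?_⟩
        by_cases hij : i = j
        · subst hij
          simp [hjA]
        · refine ⟨fun h => ?_, fun h => ?_⟩
          · have := (hn i hi).1 (hne i j n hi hjb hij h)
            exact ⟨this.1.trans (lt_add_one j), this.2⟩
          · exact ((hn i hi).2 ⟨(lt_add_one_iff_le.1 h.1).lt_of_ne hij, h.2⟩).mul_right _
      · refine ⟨n, fun i hi => ?_⟩
        rw [hn i hi, lt_add_one_iff_le, le_iff_lt_or_eq]
        constructor
        · tauto
        · rintro ⟨h | rfl, h'⟩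
          · exact ⟨h, h'⟩
          · exact absurd h' hjA
  obtain ⟨n, hn⟩ := key b le_rfl
  refine ⟨pair (pair b m) n, Set.ext fun i => ?_⟩
  rw [mem_ext_pair]
  constructor
  · rintro ⟨hi, h⟩
    exact ((hn i hi).1 h).2
  · exact fun h => ⟨hb i h, (hn i (hb i h)).2 ⟨hb i h, h⟩⟩

omit hS in
theorem IsFinCode.ext_inj {a b : M} (ha : IsFinCode a) (hb : IsFinCode b)
    (h : ext a = ext b) : a = b := by
  rcases lt_trichotomy a b with h' | h' | h'
  · exact absurd h (hb a h')
  · exact h'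
  · exact absurd h.symm (ha b h')

theorem codeOf_spec {A : Set M} (hA : A ∈ S) {b : M} (hb : ∀ x ∈ A, x < b) :
    IsFinCode (codeOf A) ∧ ext (codeOf A) = A := by
  have : Fact (A ∈ S) := ⟨hA⟩
  have hiff : ∀ c, ext c = A ↔ ∀ x, x < c + b → (x ∈ ext c ↔ x ∈ A) := by
    intro c
    constructor
    · rintro h x -
      rw [h]
    · intro h
      ext x
      exact ⟨fun hx => (h x ((lt_of_mem_ext hx).trans_le le_self_add)).1 hx,
        fun hx => (h x ((hb x hx).trans_le le_add_self)).2 hx⟩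
  obtain ⟨c, hc, hmin⟩ := exists_least S (fun c => ∀ x, x < c + b → (x ∈ ext c ↔ x ∈ A)) (by
    simpa only [hiff] using exists_ext_eq S hA hb)
  rw [← hiff] at hc
  refine pick_spec (P := fun c => IsFinCode c ∧ ext c = A) ⟨c, fun d hd h => ?_, hc⟩
  exact hmin d hd ((hiff d).1 (h.trans hc))

/-- A bounded set that is defined by a `Δ⁰₁`-formula has a code. -/
theorem codeOf_setOf (P : M → Prop) [Delta1 S fun v : Fin 1 → M => P (v 0)] (b : M)
    (hb : ∀ x, P x → x < b) : IsFinCode (codeOf {x | P x}) ∧ ext (codeOf {x | P x}) = {x | P x} :=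
  codeOf_spec S (comprehension S P) hb

include hS in
theorem codeOf_pair (x y : M) : IsFinCode (codeOf {x, y}) ∧ ext (codeOf {x, y}) = {x, y} :=
  codeOf_setOf S (fun z => z = x ∨ z = y) (x + y + 1) fun z hz => by
    rw [lt_add_one_iff_le]
    rcases hz with rfl | rfl
    · exact le_self_add
    · exact le_add_self

include hS in
theorem codeOf_empty : IsFinCode (codeOf (∅ : Set M)) ∧ ext (codeOf (∅ : Set M)) = ∅ := by
  have := codeOf_setOf S (fun z : M => z < 0) 0 fun z hz => hz
  rwa [show {z : M | z < 0} = ∅ from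
    Set.eq_empty_of_forall_notMem fun z (hz : z < 0) => not_lt_zero hz] at this

omit hS in
theorem isFinCode_iff {c : M} : IsFinCode c ↔
    ∀ b, b < c → ∃ x, x < c ∧ ¬ (x ∈ ext b ↔ x ∈ ext c) := by
  refine forall₂_congr fun b hb => ?_
  rw [Ne, Set.ext_iff, not_forall]
  constructor
  · rintro ⟨x, hx⟩
    refine ⟨x, ?_, hx⟩
    by_contra hxc
    exact hx ⟨fun h => absurd ((lt_of_mem_ext h).trans hb) hxc,
      fun h => absurd (lt_of_mem_ext h) hxc⟩
  · rintro ⟨x, -, hx⟩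
    exact ⟨x, hx⟩

variable {S}

instance Delta1.isFinCode {f : (Fin n → M) → M} [Recursive S f] :
    Delta1 S fun v => IsFinCode (f v) := by
  simp only [isFinCode_iff]
  infer_instance

end Codes

/-! ### Finite functions -/

section FiniteFunctions

variable {S : Set (Set M)} {n : ℕ} [IsArith M]

omit [IsArith M] in
theorem IsFun.ap_spec {f n i : M} {B : Set M} (hf : IsFun f n B) (hi : i < n) :
    pair i (ap f i) ∈ ext f :=
  pick_spec (hf.2.2 i hi).exists

theorem IsFun.mem_iff {f n i x : M} {B : Set M} (hf : IsFun f n B) :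
    pair i x ∈ ext f ↔ i < n ∧ x = ap f i := by
  constructor
  · intro h
    obtain ⟨j, y, hj, -, he⟩ := hf.2.1 _ h
    obtain ⟨rfl, rfl⟩ := pair_inj.1 he
    exact ⟨hj, (hf.2.2 i hj).unique h (hf.ap_spec hj)⟩
  · rintro ⟨hi, rfl⟩
    exact hf.ap_spec hi

theorem IsFun.ap_mem {f n i : M} {B : Set M} (hf : IsFun f n B) (hi : i < n) : ap f i ∈ B := by
  obtain ⟨j, y, -, hy, he⟩ := hf.2.1 _ (hf.ap_spec hi)
  obtain ⟨rfl, h⟩ := pair_inj.1 he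
  rwa [h]

theorem IsFun.mem_ext_iff {f n p : M} {B : Set M} (hf : IsFun f n B) :
    p ∈ ext f ↔ ∃ i, i < n ∧ p = pair i (ap f i) := by
  constructor
  · intro h
    obtain ⟨i, x, hi, -, rfl⟩ := hf.2.1 _ h
    exact ⟨i, hi, by rw [← (hf.mem_iff.1 h).2]⟩
  · rintro ⟨i, hi, rfl⟩
    exact hf.ap_spec hi

theorem IsFun.ext {f g n : M} {B C : Set M} (hf : IsFun f n B) (hg : IsFun g n C)
    (h : ∀ i, i < n → ap f i = ap g i) : f = g := by
  refine hf.1.ext_inj hg.1 (Set.ext fun p => ?_)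
  rw [hf.mem_ext_iff, hg.mem_ext_iff]
  exact exists_congr fun i => and_congr_right fun hi => by rw [h i hi]

theorem IsFun.length_le {f n : M} {B : Set M} (hf : IsFun f n B) : n ≤ f := by
  rcases IsArith.zero_or_add_one n with rfl | ⟨m, rfl⟩
  · exact zero_le
  · exact add_one_le_iff_lt.2 (lt_left_of_pair_mem_ext (hf.ap_spec (lt_add_one m)))

theorem IsFun.length_unique {f m n : M} {B C : Set M} (hf : IsFun f m B) (hg : IsFun f n C) :
    m = n := by
  have aux : ∀ {m n : M} {B C : Set M}, IsFun f m B → IsFun f n C → ¬ m < n := fun h h' hlt =>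
    lt_irrefl _ (h.mem_iff.1 (h'.ap_spec hlt)).1
  exact le_antisymm (not_lt.1 (aux hg hf)) (not_lt.1 (aux hf hg))

theorem IsFun.ap_lt {f n i : M} {B : Set M} (hf : IsFun f n B) (hi : i < n) : ap f i < f :=
  lt_right_of_pair_mem_ext (hf.ap_spec hi)

theorem isFun_iff {f n : M} {B : Set M} : IsFun f n B ↔ IsFinCode f ∧
    (∀ p, p < f → p ∈ ext f → ∃ i, i < p + 1 ∧ ∃ x, x < p + 1 ∧ i < n ∧ x ∈ B ∧ p = pair i x) ∧
    (∀ i, i < n → ∃ x, x < f ∧ pair i x ∈ ext f ∧ ∀ y, y < f → pair i y ∈ ext f → y = x) := by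
  refine and_congr_right fun _ => and_congr ?_ (forall₂_congr fun i _ => ?_)
  · refine forall_congr' fun p => ⟨?_, ?_⟩
    · rintro h - hp
      obtain ⟨i, x, hi, hx, rfl⟩ := h hp
      exact ⟨i, lt_add_one_iff_le.2 (le_pair_left _ _), x, lt_add_one_iff_le.2 (le_pair_right _ _),
        hi, hx, rfl⟩
    · intro h hp
      obtain ⟨i, -, x, -, h⟩ := h (lt_of_mem_ext hp) hp
      exact ⟨i, x, h⟩
  · constructor
    · rintro ⟨x, hx, h⟩
      exact ⟨x, lt_right_of_pair_mem_ext hx, hx, fun y _ hy => h y hy⟩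
    · rintro ⟨x, -, hx, h⟩
      exact ⟨x, hx, fun y hy => h y (lt_right_of_pair_mem_ext hy) hy⟩

theorem isEmb_iff_ap {f n : M} {A : OrdData M} : IsEmb f n A ↔ IsFun f n A.carrier ∧
    ∀ i j, i < j → j < n → A.lt (ap f i) (ap f j) := by
  refine and_congr_right fun hf => ⟨fun h i j hij hj => ?_, fun h i j x y hx hy hij => ?_⟩
  · exact h i j _ _ (hf.ap_spec (hij.trans hj)) (hf.ap_spec hj) hij
  · rw [hf.mem_iff] at hx hy
    rw [hx.2, hy.2]
    exact h i j hij hy.1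

variable [hS : Fact (IsModelRCA0 S)]

instance Delta1.isFun {B : Set M} [Fact (B ∈ S)] {f g : (Fin n → M) → M} [Recursive S f]
    [Recursive S g] : Delta1 S fun v => IsFun (f v) (g v) B := by
  simp only [isFun_iff]
  infer_instance

variable (S)

/-- A function on `n` that is defined by a `Σ⁰₁`-formula has a code. -/
theorem exists_isFun (n : M) (F : M → M) (R : M → M → Prop)
    [hR : Sigma1 S fun v : Fin 2 → M => R (v 0) (v 1)]
    (hF : ∀ i, i < n → ∀ x, R i x ↔ x = F i) {B : Set M} (hB : ∀ i, i < n → F i ∈ B) :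
    ∃ f, IsFun f n B ∧ ∀ i, i < n → ap f i = F i := by
  have hR' : ∀ {k : ℕ} (i j : Fin k), Sigma1 S fun v : Fin k → M => R (v i) (v j) := fun i j =>
    hR.rename ![i, j]
  -- by `Σ⁰₁`-induction, the values of `F` have a common bound
  obtain ⟨b, hb⟩ : ∃ b, ∀ i, i < n → ∃ x, x < b ∧ R i x := by
    have := sigma_induction S (fun c => n < c ∨ ∃ b, ∀ i, i < c → ∃ x, x < b ∧ R i x) ?_ ?_ n
    · exact this.resolve_left (lt_irrefl n)
    · exact Or.inr ⟨0, fun i hi => absurd hi not_lt_zero⟩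
    · rintro c (hc | ⟨b, hb⟩)
      · exact Or.inl (hc.trans (lt_add_one c))
      · rcases lt_or_ge c n with hc | hc
        · refine Or.inr ⟨b + (F c + 1), fun i hi => ?_⟩
          rcases (lt_add_one_iff_le.1 hi).lt_or_eq with hi | rfl
          · obtain ⟨x, hx, h⟩ := hb i hi
            exact ⟨x, hx.trans_le le_self_add, h⟩
          · exact ⟨F i, (lt_add_one _).trans_le le_add_self, (hF i hc _).2 rfl⟩
        · exact Or.inl (lt_add_one_iff_le.2 hc)
  have hFb : ∀ i, i < n → F i < b := fun i hi => by
    obtain ⟨x, hx, h⟩ := hb i hi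
    rwa [← (hF i hi x).1 h]
  have h_delta : Delta1 S fun v : Fin 1 → M =>
      ∃ i, i < n ∧ ∃ x, x < b ∧ v 0 = pair i x ∧ R i x := by
    refine ⟨inferInstance, ?_⟩
    -- the complement is `Σ⁰₁` as well, since the values of `F` are unique
    have : Sigma1 S fun v : Fin 1 → M => ∀ i, i < n → ∀ x, x < b →
        v 0 ≠ pair i x ∨ ∃ y, R i y ∧ y ≠ x := inferInstance
    refine this.congr fun v => ?_
    simp only [not_exists, not_and]
    refine forall₂_congr fun i hi => forall₂_congr fun x hx => ?_
    rw [imp_iff_not_or]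
    refine or_congr Iff.rfl ?_
    simp only [hF i hi]
    simp [eq_comm]
  obtain ⟨h1, h2⟩ := codeOf_setOf S (fun p => ∃ i, i < n ∧ ∃ x, x < b ∧ p = pair i x ∧ R i x)
    (pair n b) (by
      rintro p ⟨i, hi, x, hx, rfl, -⟩
      exact pair_lt_pair hi hx)
  have hmem : ∀ i x, pair i x ∈ ext (codeOf {p | ∃ i, i < n ∧ ∃ x, x < b ∧ p = pair i x ∧ R i x}) ↔
      i < n ∧ x = F i := by
    intro i x
    rw [h2]
    constructor
    · rintro ⟨j, hj, y, hy, h, hR⟩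
      obtain ⟨rfl, rfl⟩ := pair_inj.1 h
      exact ⟨hj, (hF i hj x).1 hR⟩
    · rintro ⟨hi, rfl⟩
      exact ⟨i, hi, F i, hFb i hi, rfl, (hF i hi _).2 rfl⟩
  have hfun : IsFun (codeOf {p | ∃ i, i < n ∧ ∃ x, x < b ∧ p = pair i x ∧ R i x}) n B := by
    refine ⟨h1, fun p hp => ?_, fun i hi => ⟨F i, (hmem _ _).2 ⟨hi, rfl⟩, fun x hx =>
      ((hmem _ _).1 hx).2⟩⟩
    rw [h2] at hp
    obtain ⟨i, hi, x, hx, rfl, hR⟩ := hp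
    exact ⟨i, x, hi, by rw [(hF i hi x).1 hR]; exact hB i hi, rfl⟩
  exact ⟨_, hfun, fun i hi => ((hmem _ _).1 (hfun.ap_spec hi)).2⟩

end FiniteFunctions

/-! ### Recursion -/

section Recursion

variable (S : Set (Set M)) [IsArith M] [hS : Fact (IsModelRCA0 S)]

/-- Primitive recursion along the numbers of the model. The step function is only required to
behave well on the domain `Dom`. -/
theorem exists_recursion (a : M) (Dom : M → M → Prop) (F : M → M → M)
    (hF : Sigma1 S fun v : Fin 3 → M => Dom (v 0) (v 1) ∧ v 2 = F (v 0) (v 1))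
    (h0 : Dom 0 a) (h1 : ∀ n u, Dom n u → Dom (n + 1) (F n u)) :
    ∃ h : M → M, Recursive S (fun v : Fin 1 → M => h (v 0)) ∧ h 0 = a ∧
      (∀ n, Dom n (h n)) ∧ ∀ n, h (n + 1) = F n (h n) := by
  have hF' : ∀ {k : ℕ} (i j l : Fin k),
      Sigma1 S fun v : Fin k → M => Dom (v i) (v j) ∧ v l = F (v i) (v j) := fun i j l =>
    hF.rename ![i, j, l]
  -- `s` codes a set of pairs in which every pair but `⟨0, a⟩` is obtained from its predecessor
  let C : M → Prop := fun s => ∀ p, p < s → p ∈ ext s → p = pair 0 a ∨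
    ∃ i u w, pair i u ∈ ext s ∧ p = pair (i + 1) w ∧ (Dom i u ∧ w = F i u)
  have hC_sig : ∀ {k : ℕ} (i : Fin k), Sigma1 S fun v : Fin k → M => C (v i) := fun i => by
    show Sigma1 S fun v => ∀ p, p < v i → p ∈ ext (v i) → p = pair 0 a ∨
      ∃ j u w, pair j u ∈ ext (v i) ∧ p = pair (j + 1) w ∧ (Dom j u ∧ w = F j u)
    infer_instance
  have hC : ∀ s, C s → ∀ n x, pair n x ∈ ext s → (n = 0 ∧ x = a) ∨
      ∃ i u, pair i u ∈ ext s ∧ n = i + 1 ∧ Dom i u ∧ x = F i u := by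
    intro s h n x hx
    rcases h _ (lt_of_mem_ext hx) hx with h | ⟨i, u, w, hu, h, hD, rfl⟩
    · exact Or.inl (pair_inj.1 h)
    · obtain ⟨rfl, rfl⟩ := pair_inj.1 h
      exact Or.inr ⟨i, u, hu, rfl, hD, rfl⟩
  have hdom : ∀ s, C s → ∀ n x, pair n x ∈ ext s → Dom n x := by
    intro s hs n x hx
    rcases hC s hs n x hx with ⟨rfl, rfl⟩ | ⟨i, u, -, rfl, hD, rfl⟩
    · exact h0
    · exact h1 i u hD
  have hex : ∀ n, ∃ s, C s ∧ ∃ x, pair n x ∈ ext s := by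
    refine sigma_induction S (fun n => ∃ s, C s ∧ ∃ x, pair n x ∈ ext s) ?_ ?_
    · obtain ⟨-, h⟩ := codeOf_pair S (pair 0 a) (pair 0 a)
      refine ⟨_, fun p _ hp => Or.inl ?_, a, by rw [h]; simp⟩
      rw [h] at hp
      simpa using hp
    · rintro n ⟨s, hs, x, hx⟩
      obtain ⟨-, h⟩ := codeOf_setOf S (fun p => p ∈ ext s ∨ p = pair (n + 1) (F n x))
        (s + (pair (n + 1) (F n x) + 1)) (by
          rintro p (hp | rfl)
          · exact (lt_of_mem_ext hp).trans_le le_self_add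
          · exact (lt_add_one _).trans_le le_add_self)
      refine ⟨_, fun p _ hp => ?_, F n x, by rw [h]; exact Or.inr rfl⟩
      rw [h] at hp ⊢
      rcases hp with hp | rfl
      · rcases hs p (lt_of_mem_ext hp) hp with h' | ⟨i, u, w, hu, h'⟩
        · exact Or.inl h'
        · exact Or.inr ⟨i, u, w, Or.inl hu, h'⟩
      · exact Or.inr ⟨n, x, _, Or.inl hx, rfl, hdom s hs n x hx, rfl⟩
  have huniq : ∀ s t, C s → C t → ∀ n, ∀ x, x < s → ∀ y, y < t → pair n x ∈ ext s →
      pair n y ∈ ext t → x = y := by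
    intro s t hs ht
    refine sigma_induction S _ ?_ ?_
    · intro x _ y _ hx hy
      rcases hC s hs 0 x hx with ⟨-, rfl⟩ | ⟨i, u, -, h, -⟩
      · rcases hC t ht 0 y hy with ⟨-, rfl⟩ | ⟨i, u, -, h, -⟩
        · rfl
        · exact absurd h.symm (IsArith.add_one_ne_zero i)
      · exact absurd h.symm (IsArith.add_one_ne_zero i)
    · intro n ih x _ y _ hx hy
      rcases hC s hs _ x hx with ⟨h, -⟩ | ⟨i, u, hu, hi, -, rfl⟩
      · exact absurd h (IsArith.add_one_ne_zero n)
      rcases hC t ht _ y hy with ⟨h, -⟩ | ⟨j, w, hw, hj, -, rfl⟩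
      · exact absurd h (IsArith.add_one_ne_zero n)
      obtain rfl := add_right_cancel hi
      obtain rfl := add_right_cancel hj
      rw [ih u (lt_right_of_pair_mem_ext hu) w (lt_right_of_pair_mem_ext hw) hu hw]
  choose s hs h hh using hex
  have huniq' : ∀ t, C t → ∀ n x, pair n x ∈ ext t → x = h n := fun t ht n x hx =>
    huniq t (s n) ht (hs n) n x (lt_right_of_pair_mem_ext hx) _ (lt_right_of_pair_mem_ext (hh n)) hx
      (hh n)
  refine ⟨h, ⟨?_⟩, ?_, fun n => hdom _ (hs n) _ _ (hh n), fun n => ?_⟩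
  · have : Sigma1 S fun w : Fin 2 → M => ∃ t, C t ∧ pair (w 1) (w 0) ∈ ext t := inferInstance
    refine this.congr fun w => ⟨fun hw => ⟨s (w 1), hs _, ?_⟩,
      fun ⟨t, ht, hw⟩ => huniq' t ht _ _ hw⟩
    rw [hw]
    exact hh (w 1)
  · rcases hC _ (hs 0) _ _ (hh 0) with ⟨-, h⟩ | ⟨i, u, -, h, -⟩
    · exact h
    · exact absurd h.symm (IsArith.add_one_ne_zero i)
  · rcases hC _ (hs (n + 1)) _ _ (hh (n + 1)) with ⟨h, -⟩ | ⟨i, u, hu, hi, -, hF⟩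
    · exact absurd h (IsArith.add_one_ne_zero n)
    · obtain rfl := add_right_cancel hi
      rw [hF, huniq' _ (hs _) _ _ hu]

end Recursion

/-! ### Embeddings and enumerations -/

section Orders

variable {S : Set (Set M)}

omit [ArithStr M] in
theorem OrdData.IsLinear.asymm {A : OrdData M} (hA : A.IsLinear) {x y : M} (h : A.lt x y) :
    ¬ A.lt y x :=
  fun h' => hA.irrefl x (hA.trans _ _ _ h h')

omit [ArithStr M] in
theorem IsIncr.injective {A B : OrdData M} {h : M → M} (hh : IsIncr A B h) (hA : A.IsLinear)
    (hB : B.IsLinear) {x y : M} (hx : x ∈ A.carrier) (hy : y ∈ A.carrier) (e : h x = h y) :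
    x = y := by
  rcases hA.total x y hx hy with h' | h' | h'
  · exact absurd (e ▸ hh.2 x y hx hy h') (hB.irrefl _)
  · exact h'
  · exact absurd (e ▸ hh.2 y x hy hx h') (hB.irrefl _)

variable [IsArith M]

theorem IsEmb.ap_mem {f n i : M} {A : OrdData M} (hf : IsEmb f n A) (hi : i < n) :
    ap f i ∈ A.carrier :=
  hf.1.ap_mem hi

theorem IsEmb.lt {f n i j : M} {A : OrdData M} (hf : IsEmb f n A) (hij : i < j) (hj : j < n) :
    A.lt (ap f i) (ap f j) :=
  (isEmb_iff_ap.1 hf).2 i j hij hj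

theorem IsEmb.lt_iff {f n i j : M} {A : OrdData M} (hf : IsEmb f n A) (hA : A.IsLinear)
    (hi : i < n) (hj : j < n) : A.lt (ap f i) (ap f j) ↔ i < j := by
  refine ⟨fun h => ?_, fun h => hf.lt h hj⟩
  rcases lt_trichotomy i j with h' | rfl | h'
  · exact h'
  · exact absurd h (hA.irrefl _)
  · exact absurd h (hA.asymm (hf.lt h' hi))

theorem IsEmb.injective {f n i j : M} {A : OrdData M} (hf : IsEmb f n A) (hA : A.IsLinear)
    (hi : i < n) (hj : j < n) (h : ap f i = ap f j) : i = j := by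
  rcases lt_trichotomy i j with h' | h' | h'
  · exact absurd (h ▸ hf.lt h' hj) (hA.irrefl _)
  · exact h'
  · exact absurd (h ▸ hf.lt h' hi) (hA.irrefl _)

theorem IsEmb.ap_lt {f n m i : M} (hf : IsEmb f n (natOrd m)) (hi : i < n) : ap f i < m :=
  hf.ap_mem hi

theorem IsEnum.mem_iff {A : OrdData M} {e c a x : M} (h : IsEnum A e c a) :
    x ∈ ext a ↔ ∃ i, i < c ∧ x = ap e i := by
  rw [h.2]
  exact exists_congr fun i => h.1.1.mem_iff

theorem IsEnum.ap_mem {A : OrdData M} {e c a i : M} (h : IsEnum A e c a) (hi : i < c) :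
    ap e i ∈ ext a :=
  h.mem_iff.2 ⟨i, hi, rfl⟩

variable [hS : Fact (IsModelRCA0 S)]

variable (S) in
include hS in
theorem exists_isFun_of_rel (n : M) (R : M → M → Prop)
    [Sigma1 S fun v : Fin 2 → M => R (v 0) (v 1)] {B : Set M}
    (h : ∀ i, i < n → ∃ x ∈ B, ∀ y, R i y ↔ y = x) :
    ∃ f, IsFun f n B ∧ ∀ i, i < n → ∀ x, R i x ↔ x = ap f i := by
  have h' : ∀ i, ∃ x, i < n → x ∈ B ∧ ∀ y, R i y ↔ y = x := fun i => by
    by_cases hi : i < n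
    · obtain ⟨x, hx⟩ := h i hi
      exact ⟨x, fun _ => hx⟩
    · exact ⟨0, fun h => absurd h hi⟩
  choose F hF using h'
  obtain ⟨f, hf, hfF⟩ := exists_isFun S n F R (fun i hi => (hF i hi).2) fun i hi => (hF i hi).1
  exact ⟨f, hf, fun i hi => by rw [hfF i hi]; exact (hF i hi).2⟩

variable (S) in
include hS in
theorem exists_isEmb (n : M) (F : M → M) (R : M → M → Prop)
    [Sigma1 S fun v : Fin 2 → M => R (v 0) (v 1)] {A : OrdData M}
    (hF : ∀ i, i < n → ∀ x, R i x ↔ x = F i) (hA : ∀ i, i < n → F i ∈ A.carrier)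
    (hlt : ∀ i j, i < j → j < n → A.lt (F i) (F j)) :
    ∃ f, IsEmb f n A ∧ ∀ i, i < n → ap f i = F i := by
  obtain ⟨f, hf, hfF⟩ := exists_isFun S n F R hF hA
  refine ⟨f, isEmb_iff_ap.2 ⟨hf, fun i j hij hj => ?_⟩, hfF⟩
  rw [hfF i (hij.trans hj), hfF j hj]
  exact hlt i j hij hj

variable (S) in
include hS in
theorem exists_isEmb_comp {n m f g : M} {A : OrdData M} (hf : IsEmb f n (natOrd m))
    (hg : IsEmb g m A) : ∃ h, IsEmb h n A ∧ ∀ i, i < n → ap h i = ap g (ap f i) := by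
  refine exists_isEmb S n (fun i => ap g (ap f i))
    (fun i x => ∃ j, pair i j ∈ ext f ∧ pair j x ∈ ext g) (fun i hi x => ?_)
    (fun i hi => hg.ap_mem (hf.ap_lt hi)) fun i j hij hj => hg.lt (hf.lt hij hj).1 (hf.ap_lt hj)
  simp only [hf.1.mem_iff, hg.1.mem_iff]
  constructor
  · rintro ⟨j, ⟨-, rfl⟩, -, rfl⟩
    rfl
  · rintro rfl
    exact ⟨_, ⟨hi, rfl⟩, hf.ap_lt hi, rfl⟩

variable (S) in
include hS in
theorem exists_isEmb_restrict {n k f : M} {A : OrdData M} (hf : IsEmb f n A) (hk : k ≤ n) :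
    ∃ g, IsEmb g k A ∧ ∀ i, i < k → ap g i = ap f i := by
  refine exists_isEmb S k (fun i => ap f i) (fun i x => pair i x ∈ ext f) (fun i hi x => ?_)
    (fun i hi => hf.ap_mem (hi.trans_le hk)) fun i j hij hj => hf.lt hij (hj.trans_le hk)
  rw [hf.1.mem_iff]
  exact and_iff_right (hi.trans_le hk)

variable (S) in
include hS in
theorem exists_isEmb_inclusion {n k : M} (hk : k ≤ n) :
    ∃ g, IsEmb g k (natOrd n) ∧ ∀ i, i < k → ap g i = i :=
  exists_isEmb S k (fun i => i) (fun i x => x = i) (fun _ _ _ => Iff.rfl)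
    (fun _ hi => lt_of_lt_of_le hi hk) fun _ _ hij hj => ⟨hij, hj.trans_le hk⟩

variable (S) in
include hS in
open Classical in
/-- The embedding of `n` into `n + 1` whose range omits `i`. -/
theorem exists_isEmb_skip (n i : M) :
    ∃ g, IsEmb g n (natOrd (n + 1)) ∧ ∀ j, j < n → ap g j = if j < i then j else j + 1 := by
  refine exists_isEmb S n (fun j => if j < i then j else j + 1)
    (fun j x => (j < i ∧ x = j) ∨ (¬ j < i ∧ x = j + 1)) (fun j hj x => ?_) (fun j hj => ?_)
    fun j k hjk hk => ⟨?_, ?_⟩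
  · by_cases h : j < i <;> simp [h]
  · show _ < _
    split_ifs
    · exact hj.trans (lt_add_one n)
    · exact add_lt_add_left hj 1
  · split_ifs with h h'
    · exact hjk
    · exact hjk.trans (lt_add_one k)
    · order
    · exact add_lt_add_left hjk 1
  · split_ifs
    · exact hk.trans (lt_add_one n)
    · exact add_lt_add_left hk 1

variable (S) in
include hS in
theorem exists_factorization {A : OrdData M} (hA : A.IsLinear) {e₀ c₀ a e c b : M}
    (h₀ : IsEnum A e₀ c₀ a) (h : IsEnum A e c b) (hab : ext a ⊆ ext b) :
    ∃ f, IsEmb f c₀ (natOrd c) ∧ ∀ i, i < c₀ → ap e (ap f i) = ap e₀ i := by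
  obtain ⟨f, hf, hfR⟩ := exists_isFun_of_rel S c₀
    (fun i j => ∃ x, pair i x ∈ ext e₀ ∧ pair j x ∈ ext e) (B := (natOrd c).carrier) (by
      intro i hi
      obtain ⟨j, hj, hij⟩ := h.mem_iff.1 (hab (h₀.ap_mem hi))
      refine ⟨j, hj, fun k => ?_⟩
      simp only [h₀.1.1.mem_iff, h.1.1.mem_iff]
      constructor
      · rintro ⟨x, ⟨-, rfl⟩, hk, hx⟩
        exact h.1.injective hA hk hj (hx.symm.trans hij)
      · rintro rfl
        exact ⟨_, ⟨hi, rfl⟩, hj, hij⟩)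
  have key : ∀ i, i < c₀ → ap e (ap f i) = ap e₀ i := fun i hi => by
    obtain ⟨x, hx, hx'⟩ := (hfR i hi _).2 rfl
    rw [h₀.1.1.mem_iff] at hx
    rw [h.1.1.mem_iff] at hx'
    exact hx'.2.symm.trans hx.2
  refine ⟨f, isEmb_iff_ap.2 ⟨hf, fun i j hij hj => ⟨?_, hf.ap_mem hj⟩⟩, key⟩
  rw [← h.1.lt_iff hA (hf.ap_mem (hij.trans hj)) (hf.ap_mem hj), key _ hj, key _ (hij.trans hj)]
  exact h₀.1.lt hij hj

omit hS in
theorem IsEmb.cancel_left {A : OrdData M} (hA : A.IsLinear) {n m f g e : M} (he : IsEmb e m A)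
    (hf : IsEmb f n (natOrd m)) (hg : IsEmb g n (natOrd m))
    (h : ∀ i, i < n → ap e (ap f i) = ap e (ap g i)) : f = g :=
  hf.1.ext hg.1 fun i hi => he.injective hA (hf.ap_lt hi) (hg.ap_lt hi) (h i hi)

variable (S) in
include hS in
theorem IsEnum.ap_eq {A : OrdData M} (hA : A.IsLinear) {e c a e' c' a' : M} (h : IsEnum A e c a)
    (h' : IsEnum A e' c' a') (haa : ext a = ext a') {i : M} (hi : i < c) :
    i < c' ∧ ap e i = ap e' i := by
  have key := sigma_induction S (fun k => ∀ i, i < k → i < c → i < c' ∧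
    ∃ x, x < e ∧ pair i x ∈ ext e ∧ pair i x ∈ ext e') (fun i hi => absurd hi not_lt_zero) ?_
    (i + 1)
  · obtain ⟨hi', x, -, hx, hx'⟩ := key i (lt_add_one i) hi
    rw [h.1.1.mem_iff] at hx
    rw [h'.1.1.mem_iff] at hx'
    exact ⟨hi', hx.2.symm.trans hx'.2⟩
  · intro k ih i hik hi
    rcases (lt_add_one_iff_le.1 hik).lt_or_eq with hik | rfl
    · exact ih i hik hi
    have ih' : ∀ j, j < i → j < c' ∧ ap e j = ap e' j := fun j hj => by
      obtain ⟨hj', x, -, hx, hx'⟩ := ih j hj (hj.trans hi)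
      rw [h.1.1.mem_iff] at hx
      rw [h'.1.1.mem_iff] at hx'
      exact ⟨hj', hx.2.symm.trans hx'.2⟩
    suffices hs : i < c' ∧ ap e i = ap e' i from
      ⟨hs.1, _, h.1.1.ap_lt hi, h.1.1.ap_spec hi, by rw [hs.2]; exact h'.1.1.ap_spec hs.1⟩
    obtain ⟨j, hj, hij⟩ := h'.mem_iff.1 (haa ▸ h.ap_mem hi)
    rcases lt_trichotomy j i with hji | rfl | hji
    · have := h.1.injective hA (hji.trans hi) hi ((ih' j hji).2.trans hij.symm)
      exact absurd this hji.ne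
    · exact ⟨hj, hij⟩
    have hi' := hji.trans hj
    obtain ⟨l, hl, hil⟩ := h.mem_iff.1 (haa.symm ▸ h'.ap_mem hi')
    rcases lt_trichotomy l i with hli | rfl | hli
    · have := h'.1.injective hA (hli.trans hi') hi' ((ih' l hli).2.symm.trans hil.symm)
      exact absurd this hli.ne
    · exact ⟨hi', hil.symm⟩
    · have h1 := h.1.lt hli hl
      have h2 := h'.1.lt hji hj
      rw [← hij, hil] at h2
      exact absurd h1 (hA.asymm h2)

variable (S) in
include hS in
/-- The increasing enumeration of a finite set is unique. -/
theorem IsEnum.unique {A : OrdData M} (hA : A.IsLinear) {e c a e' c' a' : M} (h : IsEnum A e c a)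
    (h' : IsEnum A e' c' a') (haa : ext a = ext a') : c = c' ∧ e = e' := by
  have hcc : c = c' := by
    refine le_antisymm (not_lt.1 fun hlt => ?_) (not_lt.1 fun hlt => ?_)
    · exact lt_irrefl _ (h.ap_eq S hA h' haa hlt).1
    · exact lt_irrefl _ (h'.ap_eq S hA h haa.symm hlt).1
  subst hcc
  exact ⟨rfl, h.1.1.ext h'.1.1 fun i hi => (h.ap_eq S hA h' haa hi).2⟩

instance IsLinOrd.fact_carrier {A : OrdData M} [h : Fact (IsLinOrd S A)] : Fact (A.carrier ∈ S) :=
  ⟨h.out.carrier_mem⟩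

omit hS in
instance Delta1.ord_lt {A : OrdData M} [h : Fact (IsLinOrd S A)] {n : ℕ}
    {f g : (Fin n → M) → M} [Recursive S f] [Recursive S g] :
    Delta1 S fun v => A.lt (f v) (g v) := by
  have : Fact ({p | ∃ x y, p = pair x y ∧ A.lt x y} ∈ S) := ⟨h.out.lt_mem⟩
  have : Delta1 S fun v => pair (f v) (g v) ∈ {p | ∃ x y, p = pair x y ∧ A.lt x y} := inferInstance
  refine this.congr fun v => ⟨fun h => ⟨_, _, rfl, h⟩, ?_⟩
  rintro ⟨x, y, h, h'⟩
  obtain ⟨h1, h2⟩ := pair_inj.1 h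
  rwa [h1, h2]

instance Delta1.isEmb {A : OrdData M} [h : Fact (IsLinOrd S A)] {n : ℕ}
    {f g : (Fin n → M) → M} [Recursive S f] [Recursive S g] :
    Delta1 S fun v => IsEmb (f v) (g v) A := by
  have : Delta1 S fun v => IsFun (f v) (g v) A.carrier ∧ ∀ i, i < f v → ∀ j, j < f v →
      ∀ x, x < f v → ∀ y, y < f v → pair i x ∈ ext (f v) → pair j y ∈ ext (f v) → i < j → A.lt x y := inferInstance
  refine this.congr fun v => and_congr_right fun _ => ⟨fun h i _ j _ x _ y _ => h i j x y, ?_⟩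
  intro h i j x y hx hy
  exact h i (lt_left_of_pair_mem_ext hx) j (lt_left_of_pair_mem_ext hy) x
    (lt_right_of_pair_mem_ext hx) y (lt_right_of_pair_mem_ext hy) hx hy

variable (S) in
include hS in
/-- Inserting a new element into the enumeration of a finite set. -/
theorem exists_isEmb_insert {A : OrdData M} [hA : Fact (IsLinOrd S A)] {e c z : M}
    (he : IsEmb e c A) (hz : z ∈ A.carrier) (hze : ∀ i, i < c → ap e i ≠ z) :
    ∃ e', IsEmb e' (c + 1) A ∧ ∀ x, (∃ i, pair i x ∈ ext e') ↔ x = z ∨ ∃ i, pair i x ∈ ext e := by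
  have hl := hA.out.linear
  -- the position of the new element
  obtain ⟨p, hp, hmin⟩ := exists_least S (fun p => c ≤ p ∨ ∃ y, y < e ∧ pair p y ∈ ext e ∧ A.lt z y)
    ⟨c, Or.inl le_rfl⟩
  have hpc : p ≤ c := not_lt.1 fun h => hmin c h (Or.inl le_rfl)
  have hlow : ∀ i, i < p → A.lt (ap e i) z := fun i hi => by
    have hic := hi.trans_le hpc
    rcases hl.total _ _ (he.ap_mem hic) hz with h | h | h
    · exact h
    · exact absurd h (hze i hic)
    · exact absurd (Or.inr ⟨_, he.1.ap_lt hic, he.1.ap_spec hic, h⟩) (hmin i hi)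
  have hup : ∀ i, p ≤ i → i < c → A.lt z (ap e i) := fun i hi hic => by
    have hz : A.lt z (ap e p) := by
      rcases hp with hp | ⟨y, -, hy, h⟩
      · order
      · rw [he.1.mem_iff] at hy
        rwa [← hy.2]
    rcases hi.lt_or_eq with hi | rfl
    · exact hl.trans _ _ _ hz (he.lt hi hic)
    · exact hz
  obtain ⟨f, hf, hfR⟩ := exists_isFun_of_rel S (c + 1) (fun i x => (i < p ∧ pair i x ∈ ext e) ∨
    (i = p ∧ x = z) ∨ ∃ j, i = j + 1 ∧ p ≤ j ∧ pair j x ∈ ext e) (B := A.carrier) (by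
      intro i hi
      simp only [he.1.mem_iff]
      rcases lt_trichotomy i p with h | rfl | h
      · refine ⟨_, he.ap_mem (h.trans_le hpc), fun y => ⟨?_, fun hy =>
          Or.inl ⟨h, h.trans_le hpc, hy⟩⟩⟩
        rintro (h' | h' | ⟨j, rfl, h', -⟩)
        · exact h'.2.2
        · exact absurd h'.1 h.ne
        · exact absurd ((lt_add_one j).trans h) h'.not_gt
      · refine ⟨z, hz, fun y => ⟨?_, fun hy => Or.inr (Or.inl ⟨rfl, hy⟩)⟩⟩
        rintro (h' | h' | ⟨j, rfl, h', -⟩)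
        · exact absurd h'.1 (lt_irrefl _)
        · exact h'.2
        · exact absurd (lt_add_one j) h'.not_gt
      · rcases IsArith.zero_or_add_one i with rfl | ⟨j, rfl⟩
        · exact absurd h not_lt_zero
        have hj : j < c := lt_of_add_lt_add_right hi
        refine ⟨_, he.ap_mem hj, fun y => ⟨?_, fun hy =>
          Or.inr (Or.inr ⟨j, rfl, lt_add_one_iff_le.1 h, hj, hy⟩)⟩⟩
        rintro (h' | h' | ⟨k, hk, h', -, rfl⟩)
        · exact absurd h'.1 h.not_gt
        · exact absurd h'.1 h.ne'
        · rw [add_right_cancel hk])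
  simp only [he.1.mem_iff] at hfR
  refine ⟨f, isEmb_iff_ap.2 ⟨hf, fun i j hij hj => ?_⟩, fun x => ?_⟩
  · have hj' := (hfR j hj _).2 rfl
    rcases (hfR i (hij.trans hj) _).2 rfl with ⟨h1, h2, h3⟩ | ⟨h1, h2⟩ | ⟨k, h1, h2, h3, h4⟩
    · rw [h3]
      rcases hj' with ⟨h1', h2', h3'⟩ | ⟨h1', h2'⟩ | ⟨k', h1', h2', h3', h4'⟩
      · rw [h3']
        exact he.lt hij h2'
      · rw [h2']
        exact hlow i h1
      · rw [h4']
        exact he.lt (h1.trans_le h2') h3'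
    · rw [h2]
      rcases hj' with ⟨h1', h2', h3'⟩ | ⟨h1', h2'⟩ | ⟨k', h1', h2', h3', h4'⟩
      · order
      · order
      · rw [h4']
        exact hup _ h2' h3'
    · rw [h4]
      have hpi : p < i := by rw [h1]; exact lt_add_one_iff_le.2 h2
      rcases hj' with ⟨h1', h2', h3'⟩ | ⟨h1', h2'⟩ | ⟨k', h1', h2', h3', h4'⟩
      · order
      · order
      · rw [h4']
        refine he.lt ?_ h3'
        rw [h1, h1'] at hij
        exact lt_of_add_lt_add_right hij
  · simp only [hf.mem_iff, he.1.mem_iff]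
    constructor
    · rintro ⟨i, hi, hx⟩
      rcases (hfR i hi x).2 hx with h | h | ⟨j, -, -, h⟩
      · exact Or.inr ⟨i, h.2⟩
      · exact Or.inl h.2
      · exact Or.inr ⟨j, h⟩
    · rintro (rfl | ⟨i, hi, rfl⟩)
      · have hp' : p < c + 1 := lt_add_one_iff_le.2 hpc
        exact ⟨p, hp', (hfR p hp' _).1 (Or.inr (Or.inl ⟨rfl, rfl⟩))⟩
      · rcases lt_or_ge i p with h | h
        · have hi' := hi.trans (lt_add_one c)
          exact ⟨i, hi', (hfR i hi' _).1 (Or.inl ⟨h, hi, rfl⟩)⟩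
        · have hi' : i + 1 < c + 1 := add_lt_add_left hi 1
          exact ⟨i + 1, hi', (hfR _ hi' _).1 (Or.inr (Or.inr ⟨i, rfl, h, hi, rfl⟩))⟩

variable (S) in
include hS in
/-- Every finite subset of a linear order has an increasing enumeration. -/
theorem exists_isEnum {A : OrdData M} [hA : Fact (IsLinOrd S A)] {a : M} (ha : ext a ⊆ A.carrier) :
    ∃ c e, IsEnum A e c a := by
  -- induction on `k` yields enumerations of the sets `{x ∈ a | x < k}`
  have key : ∀ k, ∃ e c, IsEmb e c A ∧
      ∀ x, x < a + e → ((x ∈ ext a ∧ x < k) ↔ ∃ i, i < e ∧ pair i x ∈ ext e) := by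
    have hiff : ∀ k e, (∀ x, x < a + e → ((x ∈ ext a ∧ x < k) ↔ ∃ i, i < e ∧ pair i x ∈ ext e)) ↔
        ∀ x, ((x ∈ ext a ∧ x < k) ↔ ∃ i, pair i x ∈ ext e) := by
      intro k e
      have hb : ∀ x, (∃ i, i < e ∧ pair i x ∈ ext e) ↔ ∃ i, pair i x ∈ ext e := fun x =>
        exists_congr fun i => and_iff_right_of_imp lt_left_of_pair_mem_ext
      simp only [hb]
      refine ⟨fun h x => ⟨fun hx => ?_, fun hx => ?_⟩, fun h x _ => h x⟩
      · exact (h x ((lt_of_mem_ext hx.1).trans_le le_self_add)).1 hx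
      · obtain ⟨i, hi⟩ := hx
        exact (h x ((lt_right_of_pair_mem_ext hi).trans_le le_add_self)).2 ⟨i, hi⟩
    refine sigma_induction S _ ?_ ?_
    · obtain ⟨f, hf, -⟩ := exists_isEmb S (0 : M) (fun i => i) (fun i x => x = i) (A := A)
        (fun _ _ _ => Iff.rfl) (fun i hi => absurd hi not_lt_zero)
        fun i j _ hj => absurd hj not_lt_zero
      refine ⟨f, 0, hf, (hiff _ _).2 fun x => ⟨fun h => absurd h.2 not_lt_zero, ?_⟩⟩
      rintro ⟨i, hi⟩
      exact absurd (hf.1.mem_iff.1 hi).1 not_lt_zero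
    · rintro k ⟨e, c, he, hk⟩
      rw [hiff] at hk
      simp only [hiff]
      by_cases hka : k ∈ ext a
      · obtain ⟨e', he', h⟩ := exists_isEmb_insert S he (ha hka) (fun i hi h => by
          have := (hk k).2 ⟨i, by rw [← h]; exact he.1.ap_spec hi⟩
          exact lt_irrefl _ this.2)
        refine ⟨e', c + 1, he', fun x => ?_⟩
        rw [h, ← hk, lt_add_one_iff_le, le_iff_lt_or_eq]
        constructor
        · tauto
        · rintro (rfl | h)
          · exact ⟨hka, Or.inr rfl⟩
          · tauto
      · refine ⟨e, c, he, fun x => ?_⟩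
        rw [← hk, lt_add_one_iff_le, le_iff_lt_or_eq]
        constructor
        · rintro ⟨h, h' | rfl⟩
          · exact ⟨h, h'⟩
          · exact absurd h hka
        · tauto
  obtain ⟨e, c, he, h⟩ := key a
  refine ⟨c, e, he, fun x => ⟨fun hx => ?_, ?_⟩⟩
  · obtain ⟨i, -, hi⟩ := (h x ((lt_of_mem_ext hx).trans_le le_self_add)).1 ⟨hx, lt_of_mem_ext hx⟩
    exact ⟨i, hi⟩
  · rintro ⟨i, hi⟩
    exact ((h x ((lt_right_of_pair_mem_ext hi).trans_le le_add_self)).2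
      ⟨i, lt_left_of_pair_mem_ext hi, hi⟩).1

end Orders

/-! ### The order `D^T(A)` -/

section DOrder

variable {S : Set (Set M)}

/-- `p = ⟨a, σ⟩` is an element of `D^T(A)`, and `e` enumerates `a` by its cardinality `c`. -/
def IsDElem (T : DilData M) (A : OrdData M) (p a σ c e : M) : Prop :=
  p = pair a σ ∧ IsFinCode a ∧ ext a ⊆ A.carrier ∧ IsEnum A e c a ∧
    σ ∈ (T.ord c).carrier ∧ ext (T.supp c σ) = {i | i < c}

theorem IsDElem.mem {T : DilData M} {A : OrdData M} {p a σ c e : M} (h : IsDElem T A p a σ c e) :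
    p ∈ (D T A).carrier :=
  ⟨a, σ, c, e, h⟩

variable [IsArith M] [hS : Fact (IsModelRCA0 S)]

variable (S) in
include hS in
/-- The order of `D^T(A)` may be checked on an arbitrary common enumeration. -/
theorem IsDElem.lt {T : DilData M} {A : OrdData M} [hA : Fact (IsLinOrd S A)]
    {p a₀ σ₀ c₀ e₀ q a₁ σ₁ c₁ e₁ : M} (hp : IsDElem T A p a₀ σ₀ c₀ e₀)
    (hq : IsDElem T A q a₁ σ₁ c₁ e₁)
    (h : ∀ c e f₀ f₁, IsEmb e c A →
      IsEmb f₀ c₀ (natOrd c) → (∀ i, i < c₀ → ap e (ap f₀ i) = ap e₀ i) →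
      IsEmb f₁ c₁ (natOrd c) → (∀ i, i < c₁ → ap e (ap f₁ i) = ap e₁ i) →
      (T.ord c).lt (T.map c₀ c f₀ σ₀) (T.map c₁ c f₁ σ₁)) : (D T A).lt p q := by
  obtain ⟨h1, h2⟩ := codeOf_setOf S (fun x => x ∈ ext a₀ ∨ x ∈ ext a₁) (a₀ + a₁) (by
    rintro x (hx | hx)
    · exact (lt_of_mem_ext hx).trans_le le_self_add
    · exact (lt_of_mem_ext hx).trans_le le_add_self)
  obtain ⟨c, e, he⟩ := exists_isEnum S (A := A) (a := codeOf {x | x ∈ ext a₀ ∨ x ∈ ext a₁}) (by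
    rw [h2]
    rintro x (hx | hx)
    · exact hp.2.2.1 hx
    · exact hq.2.2.1 hx)
  obtain ⟨f₀, hf₀, hef₀⟩ := exists_factorization S hA.out.linear hp.2.2.2.1 he (by
    rw [h2]; exact fun x => Or.inl)
  obtain ⟨f₁, hf₁, hef₁⟩ := exists_factorization S hA.out.linear hq.2.2.2.1 he (by
    rw [h2]; exact fun x => Or.inr)
  exact ⟨a₀, σ₀, c₀, e₀, a₁, σ₁, c₁, e₁, _, c, e, f₀, f₁, hp, hq, ⟨h1, h2, he⟩, ⟨hf₀, hef₀⟩,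
    ⟨hf₁, hef₁⟩, h c e f₀ f₁ he.1 hf₀ hef₀ hf₁ hef₁⟩

variable (S) in
include hS in
theorem D_asymm {T : DilData M} (hT : ∀ n, (T.ord n).IsLinear) {A : OrdData M} (hA : A.IsLinear)
    {p q : M} (h : (D T A).lt p q) : ¬ (D T A).lt q p := by
  rintro ⟨a₁', σ₁', c₁', e₁', a₀', σ₀', c₀', e₀', b', c', e', f₁', f₀', hq', hp', hb', hf₁', hf₀',
    hlt'⟩
  obtain ⟨a₀, σ₀, c₀, e₀, a₁, σ₁, c₁, e₁, b, c, e, f₀, f₁, hp, hq, hb, hf₀, hf₁, hlt⟩ := h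
  obtain ⟨rfl, rfl⟩ := pair_inj.1 (hp.1.symm.trans hp'.1)
  obtain ⟨rfl, rfl⟩ := pair_inj.1 (hq.1.symm.trans hq'.1)
  obtain ⟨rfl, rfl⟩ := hp.2.2.2.1.unique S hA hp'.2.2.2.1 rfl
  obtain ⟨rfl, rfl⟩ := hq.2.2.2.1.unique S hA hq'.2.2.2.1 rfl
  obtain ⟨rfl, rfl⟩ := hb.2.2.unique S hA hb'.2.2 (by rw [hb.2.1, hb'.2.1, Set.union_comm])
  obtain rfl := IsEmb.cancel_left hA hb.2.2.1 hf₀.1 hf₀'.1 fun i hi => by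
    rw [hf₀.2 i hi, hf₀'.2 i hi]
  obtain rfl := IsEmb.cancel_left hA hb.2.2.1 hf₁.1 hf₁'.1 fun i hi => by
    rw [hf₁.2 i hi, hf₁'.2 i hi]
  exact (hT c).asymm hlt hlt'

end DOrder

/-! ### The elements of `F` -/

section FElements

variable {S : Set (Set M)}

/-- The element `⟨1, 0⟩` of `F(2)`, which has full support. -/
def topPair : M := pair (1 + 1) (0 + 1) + 1

variable [IsArith M]

theorem lt_one_add_one_iff {i : M} : i < 1 + 1 ↔ i = 0 ∨ i = 1 := by
  rw [lt_add_one_iff_le, le_iff_lt_or_eq, ← zero_add (1 : M), lt_add_one_iff_le, zero_add]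
  simp

omit [IsArith M] in
theorem FMap_zero (h : M → M) : FMap h 0 = 0 := if_pos rfl

theorem FMap_topPair (h : M → M) : FMap h topPair = pair (h 1 + 1) (h 0 + 1) + 1 := by
  have hne : ∀ a : M, a + 1 ≠ 0 := IsArith.add_one_ne_zero
  rw [FMap, topPair, if_neg (hne _), pred_add_one, fst_pair, snd_pair, onePlusMap, onePlusMap,
    if_neg (hne _), if_neg (hne _), pred_add_one, pred_add_one]

omit [IsArith M] in
theorem mem_onePlus_natOrd {x n : M} (hx : x < n) : x + 1 ∈ (onePlus (natOrd n)).carrier :=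
  Or.inr ⟨x, hx, rfl⟩

theorem onePlus_natOrd_lt {x y n : M} (hy : y < x) (hx : x < n) :
    (onePlus (natOrd n)).lt (y + 1) (x + 1) :=
  Or.inr ⟨y, hy.trans hx, x, hx, rfl, rfl, hy, hx⟩

theorem pair_mem_FOrd {x y n : M} (hy : y < x) (hx : x < n) :
    pair (x + 1) (y + 1) + 1 ∈ (FOrd (natOrd n)).carrier :=
  Or.inr ⟨_, mem_onePlus_natOrd hx, _, mem_onePlus_natOrd (hy.trans hx),
    onePlus_natOrd_lt hy hx, rfl⟩

theorem FOrd_zero_lt {x y n : M} (hy : y < x) (hx : x < n) :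
    (FOrd (natOrd n)).lt 0 (pair (x + 1) (y + 1) + 1) :=
  Or.inl ⟨rfl, _, mem_onePlus_natOrd hx, _, mem_onePlus_natOrd (hy.trans hx),
    onePlus_natOrd_lt hy hx, rfl⟩

theorem FOrd_pair_lt {x y x' y' n : M} (hy : y < x) (hx : x < n) (hy' : y' < x') (hx' : x' < n)
    (h : x < x' ∨ x = x' ∧ y < y') :
    (FOrd (natOrd n)).lt (pair (x + 1) (y + 1) + 1) (pair (x' + 1) (y' + 1) + 1) := by
  refine Or.inr ⟨_, mem_onePlus_natOrd hx, _, mem_onePlus_natOrd (hy.trans hx), _,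
    mem_onePlus_natOrd hx', _, mem_onePlus_natOrd (hy'.trans hx'), onePlus_natOrd_lt hy hx, rfl,
    onePlus_natOrd_lt hy' hx', rfl, ?_⟩
  rcases h with h | ⟨rfl, h⟩
  · exact Or.inl (onePlus_natOrd_lt h hx')
  · exact Or.inr ⟨rfl, onePlus_natOrd_lt h (hy'.trans hx')⟩

variable [hS : Fact (IsModelRCA0 S)]

variable (S) in
include hS in
theorem ext_FSupp_zero : ext (FSupp (0 : M)) = ∅ := by
  have : {x : M | (0 : M) ≠ 0 ∧ (x + 1 = fst (pred 0) ∨ x + 1 = snd (pred 0))} = ∅ := by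
    ext; simp
  rw [FSupp, this]
  exact (codeOf_empty S).2

variable (S) in
include hS in
theorem ext_FSupp_topPair : ext (FSupp (topPair : M)) = {i : M | i < 1 + 1} := by
  have : {x : M | (topPair : M) ≠ 0 ∧ (x + 1 = fst (pred topPair) ∨ x + 1 = snd (pred topPair))} =
      {1, 0} := by
    ext x
    have h : (topPair : M) ≠ 0 := IsArith.add_one_ne_zero _
    rw [Set.mem_ofPred_eq, and_iff_right h]
    simp only [topPair, pred_add_one, fst_pair, snd_pair, add_left_inj]
    rfl
  rw [FSupp, this, (codeOf_pair S 1 0).2]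
  ext i
  rw [Set.mem_ofPred_eq, lt_one_add_one_iff]
  simp [or_comm]

variable (S) in
include hS in
/-- For `u < v` in `A`, the element `⟨v, u⟩` of `F(A)` corresponds to the element
`⟨{u, v}, ⟨1, 0⟩⟩` of `D^F(A)`. -/
theorem exists_isDElem_pair {A : OrdData M} (hA : A.IsLinear) {u v : M} (huv : A.lt u v) :
    ∃ e, IsDElem F A (pair (codeOf {u, v}) topPair) (codeOf {u, v}) topPair (1 + 1) e ∧
      ap e 0 = u ∧ ap e 1 = v := by
  classical
  have h01 : (0 : M) < 1 := zero_lt_one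
  obtain ⟨e, he, hap⟩ := exists_isEmb S (1 + 1) (fun i => if i = 0 then u else v)
    (fun i x => (i = 0 ∧ x = u) ∨ (i ≠ 0 ∧ x = v)) (A := A)
    (fun i _ x => by by_cases h : i = 0 <;> simp [h])
    (fun i _ => by
      by_cases h : i = 0
      · simpa [h] using (hA.dom _ _ huv).1
      · simpa [h] using (hA.dom _ _ huv).2)
    (fun i j hij hj => by
      have hj' : j ≠ 0 := (zero_le.trans_lt hij).ne'
      have hi' : i = 0 := by
        rcases lt_one_add_one_iff.1 (hij.trans hj) with h | h
        · exact h
        · rcases lt_one_add_one_iff.1 hj with h' | h'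
          · exact absurd h' hj'
          · rw [h, h'] at hij
            exact absurd hij (lt_irrefl _)
      simpa [hj', hi'] using huv)
  have h0 : ap e 0 = u := by rw [hap 0 (lt_one_add_one_iff.2 (Or.inl rfl)), if_pos rfl]
  have h1 : ap e 1 = v := by rw [hap 1 (lt_one_add_one_iff.2 (Or.inr rfl)), if_neg one_ne_zero]
  obtain ⟨hc, hext⟩ := codeOf_pair S u v
  refine ⟨e, ⟨rfl, hc, ?_, ⟨he, fun x => ?_⟩, pair_mem_FOrd h01 (lt_add_one 1),
    ext_FSupp_topPair S⟩, h0, h1⟩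
  · rw [hext]
    rintro x (rfl | rfl)
    · exact (hA.dom _ _ huv).1
    · exact (hA.dom _ _ huv).2
  · rw [hext]
    simp only [he.1.mem_iff, lt_one_add_one_iff]
    constructor
    · rintro (rfl | rfl)
      · exact ⟨0, Or.inl rfl, h0.symm⟩
      · exact ⟨1, Or.inr rfl, h1.symm⟩
    · rintro ⟨i, rfl | rfl, rfl⟩
      · exact Or.inl h0
      · exact Or.inr h1

variable (S) in
include hS in
/-- The minimal element of `F(A)` corresponds to the element `⟨∅, ⊥⟩` of `D^F(A)`. -/
theorem exists_isDElem_bot (A : OrdData M) :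
    ∃ e, IsDElem F A (pair (codeOf ∅) 0) (codeOf ∅) 0 0 e := by
  obtain ⟨e, he, -⟩ := exists_isEmb S (0 : M) (fun i => i) (fun i x => x = i) (A := A)
    (fun _ _ _ => Iff.rfl) (fun i hi => absurd hi not_lt_zero)
    fun i j _ hj => absurd hj not_lt_zero
  obtain ⟨hc, hext⟩ := codeOf_empty S
  refine ⟨e, rfl, hc, ?_, ⟨he, fun x => ?_⟩, Or.inl rfl, ?_⟩
  · rw [hext]
    exact Set.empty_subset _
  · rw [hext]
    simp [he.1.mem_iff]
  · show ext (FSupp 0) = _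
    rw [ext_FSupp_zero S]
    ext i
    simp

variable (S) in
include hS in
theorem D_F_pair_lt {A : OrdData M} [hA : Fact (IsLinOrd S A)] {u v u' v' : M} (h : A.lt u v)
    (h' : A.lt u' v') (hlt : A.lt v v' ∨ v = v' ∧ A.lt u u') :
    (D F A).lt (pair (codeOf {u, v}) topPair) (pair (codeOf {u', v'}) topPair) := by
  obtain ⟨e₀, hp, rfl, rfl⟩ := exists_isDElem_pair S hA.out.linear h
  obtain ⟨e₁, hq, rfl, rfl⟩ := exists_isDElem_pair S hA.out.linear h'
  refine hp.lt S hq fun c e f₀ f₁ he hf₀ h₀ hf₁ h₁ => ?_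
  have i0 : (0 : M) < 1 + 1 := lt_one_add_one_iff.2 (Or.inl rfl)
  have i1 : (1 : M) < 1 + 1 := lt_one_add_one_iff.2 (Or.inr rfl)
  show (FOrd (natOrd c)).lt (FMap (ap f₀) topPair) (FMap (ap f₁) topPair)
  rw [FMap_topPair, FMap_topPair]
  refine FOrd_pair_lt (hf₀.lt zero_lt_one i1).1 (hf₀.ap_lt i1) (hf₁.lt zero_lt_one i1).1
    (hf₁.ap_lt i1) ?_
  rw [← h₀ 0 i0, ← h₀ 1 i1, ← h₁ 0 i0, ← h₁ 1 i1] at hlt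
  rw [he.lt_iff hA.out.linear (hf₀.ap_lt i1) (hf₁.ap_lt i1),
    he.lt_iff hA.out.linear (hf₀.ap_lt i0) (hf₁.ap_lt i0)] at hlt
  exact hlt.imp_right fun h => ⟨he.injective hA.out.linear (hf₀.ap_lt i1) (hf₁.ap_lt i1) h.1, h.2⟩

variable (S) in
include hS in
theorem D_F_bot_lt {A : OrdData M} [hA : Fact (IsLinOrd S A)] {u v : M} (h : A.lt u v) :
    (D F A).lt (pair (codeOf ∅) 0) (pair (codeOf {u, v}) topPair) := by
  obtain ⟨e₀, hp⟩ := exists_isDElem_bot S A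
  obtain ⟨e₁, hq, rfl, rfl⟩ := exists_isDElem_pair S hA.out.linear h
  refine hp.lt S hq fun c e f₀ f₁ _ _ _ hf₁ _ => ?_
  have i1 : (1 : M) < 1 + 1 := lt_one_add_one_iff.2 (Or.inr rfl)
  show (FOrd (natOrd c)).lt (FMap (ap f₀) 0) (FMap (ap f₁) topPair)
  rw [FMap_topPair, FMap_zero]
  exact FOrd_zero_lt (hf₁.lt zero_lt_one i1).1 (hf₁.ap_lt i1)

end FElements

/-! ### The upper derivative on natural numbers -/

section UpperDerivative

variable {S : Set (Set M)}

/-- The value of `ξ` at the pair `⟨v, u⟩`, for elements `u < v` of `G(n)`. -/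
noncomputable def derivPair (ξ : M → M → M) (n v u : M) : M := ξ n (pair (codeOf {u, v}) topPair)

/-- The value of `ξ` at the minimal element of `F(G(n))`. -/
noncomputable def derivBot (ξ : M → M → M) (n : M) : M := ξ n (pair (codeOf ∅) 0)

/-- The graph of the action of `T` on morphisms. -/
def MapGraph (T : DilData M) (n m f σ τ : M) : Prop :=
  IsEmb f n (natOrd m) ∧ σ ∈ (T.ord n).carrier ∧ τ = T.map n m f σ

/-- The graph of the support functions of `T`. -/
def SuppGraph (T : DilData M) (n σ s : M) : Prop := σ ∈ (T.ord n).carrier ∧ s = T.supp n σ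

/-- The graph of the functions `μ` of `T`. -/
def MuGraph (T : DilData M) (n m τ : M) : Prop := m < n ∧ τ = T.mu n m

/-- The graph of the natural transformation `ξ : F ∘ G ⇒ G`. -/
def DerivGraph (G : DilData M) (ξ : M → M → M) (n σ τ : M) : Prop :=
  σ ∈ ((comp F G).ord n).carrier ∧ τ = ξ n σ

variable [IsArith M] {G : DilData M} {ξ : M → M → M}

section Definability

variable {k : ℕ} {f₁ f₂ f₃ f₄ f₅ : (Fin k → M) → M} [Recursive S f₁] [Recursive S f₂]
  [Recursive S f₃] [Recursive S f₄] [Recursive S f₅]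

instance Delta1.mem_ord [hG : Fact (IsNormalPraeDilator S G)] :
    Delta1 S fun v => f₂ v ∈ (G.ord (f₁ v)).carrier := by
  have := Fact.mk hG.out.carrier_mem
  have : Delta1 S fun v => pair (f₁ v) (f₂ v) ∈
    {p | ∃ n σ, p = pair n σ ∧ σ ∈ (G.ord n).carrier} := inferInstance
  refine this.congr fun v => ⟨fun h => ⟨_, _, rfl, h⟩, ?_⟩
  rintro ⟨n, σ, h, h'⟩
  obtain ⟨h1, h2⟩ := pair_inj.1 h
  rwa [h1, h2]

instance Delta1.ord_lt_uniform [hG : Fact (IsNormalPraeDilator S G)] :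
    Delta1 S fun v => (G.ord (f₁ v)).lt (f₂ v) (f₃ v) := by
  have := Fact.mk hG.out.lt_mem
  have : Delta1 S fun v => pair (f₁ v) (pair (f₂ v) (f₃ v)) ∈
    {p | ∃ n σ τ, p = pair n (pair σ τ) ∧ (G.ord n).lt σ τ} := inferInstance
  refine this.congr fun v => ⟨fun h => ⟨_, _, _, rfl, h⟩, ?_⟩
  rintro ⟨n, σ, τ, h, h'⟩
  simp only [pair_inj] at h
  obtain ⟨h1, h2, h3⟩ := h
  rwa [h1, h2, h3]

instance Delta1.mapGraph [hG : Fact (IsNormalPraeDilator S G)] :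
    Delta1 S fun v => MapGraph G (f₁ v) (f₂ v) (f₃ v) (f₄ v) (f₅ v) := by
  have := Fact.mk hG.out.map_mem
  have : Delta1 S fun v => pair (pair (pair (f₁ v) (f₂ v)) (f₃ v)) (pair (f₄ v) (f₅ v)) ∈
    {p | ∃ n m f σ, p = pair (pair (pair n m) f) (pair σ (G.map n m f σ)) ∧
      IsEmb f n (natOrd m) ∧ σ ∈ (G.ord n).carrier} := inferInstance
  refine this.congr fun v => ⟨fun ⟨h, h', h''⟩ => ⟨_, _, _, _, by rw [h''], h, h'⟩, ?_⟩
  rintro ⟨n, m, f, σ, h, h'⟩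
  simp only [pair_inj] at h
  obtain ⟨⟨⟨h1, h2⟩, h3⟩, h4, h5⟩ := h
  rw [MapGraph, h5, h1, h2, h3, h4]
  exact ⟨h'.1, h'.2, rfl⟩

instance Delta1.suppGraph [hG : Fact (IsNormalPraeDilator S G)] :
    Delta1 S fun v => SuppGraph G (f₁ v) (f₂ v) (f₃ v) := by
  have := Fact.mk hG.out.supp_mem
  have : Delta1 S fun v => pair (f₁ v) (pair (f₂ v) (f₃ v)) ∈
    {p | ∃ n σ, p = pair n (pair σ (G.supp n σ)) ∧ σ ∈ (G.ord n).carrier} := inferInstance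
  refine this.congr fun v => ⟨fun ⟨h, h'⟩ => ⟨_, _, by rw [h'], h⟩, ?_⟩
  rintro ⟨n, σ, h, h'⟩
  simp only [pair_inj] at h
  obtain ⟨h1, h2, h3⟩ := h
  rw [SuppGraph, h3, h1, h2]
  exact ⟨h', rfl⟩

instance Delta1.muGraph [hG : Fact (IsNormalPraeDilator S G)] :
    Delta1 S fun v => MuGraph G (f₁ v) (f₂ v) (f₃ v) := by
  have := Fact.mk hG.out.mu_mem
  have : Delta1 S fun v => pair (f₁ v) (pair (f₂ v) (f₃ v)) ∈
    {p | ∃ n m, p = pair n (pair m (G.mu n m)) ∧ m < n} := inferInstance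
  refine this.congr fun v => ⟨fun ⟨h, h'⟩ => ⟨_, _, by rw [h'], h⟩, ?_⟩
  rintro ⟨n, m, h, h'⟩
  simp only [pair_inj] at h
  obtain ⟨h1, h2, h3⟩ := h
  rw [MuGraph, h3, h1, h2]
  exact ⟨h', rfl⟩

instance Delta1.derivGraph [h : Fact (IsNatTrans S (comp F G) G ξ)] :
    Delta1 S fun v => DerivGraph G ξ (f₁ v) (f₂ v) (f₃ v) := by
  have := Fact.mk h.out.mem
  have : Delta1 S fun v => pair (f₁ v) (pair (f₂ v) (f₃ v)) ∈
    {p | ∃ n σ, p = pair n (pair σ (ξ n σ)) ∧ σ ∈ ((comp F G).ord n).carrier} := inferInstance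
  refine this.congr fun v => ⟨fun ⟨h, h'⟩ => ⟨_, _, by rw [h'], h⟩, ?_⟩
  rintro ⟨n, σ, h, h'⟩
  simp only [pair_inj] at h
  obtain ⟨h1, h2, h3⟩ := h
  rw [DerivGraph, h3, h1, h2]
  exact ⟨h', rfl⟩

instance Recursive.codeOf_pair [hS : Fact (IsModelRCA0 S)] :
    Recursive S fun v => codeOf {f₁ v, f₂ v} := by
  refine ⟨?_⟩
  have : Delta1 S fun w : Fin (k + 1) → M => IsFinCode (w 0) ∧
      ∀ x, x < w 0 + ((f₁ fun i => w i.succ) + (f₂ fun i => w i.succ) + 1) →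
        (x ∈ ext (w 0) ↔ x = (f₁ fun i => w i.succ) ∨ x = (f₂ fun i => w i.succ)) := inferInstance
  refine this.pos.congr fun w => ?_
  obtain ⟨hc, hext⟩ := SOA.codeOf_pair S (f₁ fun i => w i.succ) (f₂ fun i => w i.succ)
  constructor
  · intro h
    rw [h, hext]
    exact ⟨hc, fun x _ => Iff.rfl⟩
  · rintro ⟨hw, h⟩
    refine hw.ext_inj hc (Set.ext fun x => ?_)
    rw [hext]
    refine ⟨fun hx => (h x ((lt_of_mem_ext hx).trans_le le_self_add)).1 hx, fun hx => (h x ?_).2 hx⟩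
    refine lt_of_lt_of_le ?_ le_add_self
    rw [lt_add_one_iff_le]
    rcases hx with rfl | rfl
    · exact le_self_add
    · exact le_add_self

end Definability

section Dilator

variable [hS : Fact (IsModelRCA0 S)] [hG : Fact (IsNormalPraeDilator S G)]

instance isLinOrd_ord (n : M) : Fact (IsLinOrd S (G.ord n)) := by
  refine ⟨⟨hG.out.linear n, comprehension S fun σ => σ ∈ (G.ord n).carrier, ?_⟩⟩
  have := comprehension S fun p => ∃ x, x < p + 1 ∧ ∃ y, y < p + 1 ∧ p = pair x y ∧
    (G.ord n).lt x y
  convert this using 3 with p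
  constructor
  · rintro ⟨x, y, rfl, h⟩
    exact ⟨x, lt_add_one_iff_le.2 (le_pair_left _ _), y, lt_add_one_iff_le.2 (le_pair_right _ _),
      rfl, h⟩
  · rintro ⟨x, -, y, -, h⟩
    exact ⟨x, y, h⟩

omit [IsArith M] hS hG in
theorem IsPraeDilator.map_mem' (hG : IsPraeDilator S G) {n m f σ : M} (hf : IsEmb f n (natOrd m))
    (hσ : σ ∈ (G.ord n).carrier) : G.map n m f σ ∈ (G.ord m).carrier :=
  (hG.map_incr n m f hf).1 σ hσ

omit [IsArith M] hS hG in
theorem IsNormalPraeDilator.mu_mem_ord (hG : IsNormalPraeDilator S G) {n m : M} (hm : m < n) :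
    G.mu n m ∈ (G.ord n).carrier :=
  (hG.mu_incr n).1 m hm

omit [IsArith M] hS hG in
theorem IsNormalPraeDilator.map_lt_mu (hG : IsNormalPraeDilator S G) {k n f σ m : M}
    (hf : IsEmb f k (natOrd n)) (hσ : σ ∈ (G.ord k).carrier) (hm : m < n)
    (hfm : ∀ i, i < k → ap f i < m) : (G.ord n).lt (G.map k n f σ) (G.mu n m) := by
  rw [hG.normal n _ m (hG.map_mem' hf hσ) hm, hG.supp_natural k n f hf σ hσ]
  rintro _ ⟨i, hi, rfl⟩
  exact hfm i ((hG.supp_code k σ hσ).2 i hi)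

omit hS hG in
theorem IsNormalPraeDilator.mem_supp_mu (hG : IsNormalPraeDilator S G) (n : M) :
    n ∈ ext (G.supp (n + 1) (G.mu (n + 1) n)) := by
  have hn := lt_add_one n
  have hmem := hG.mu_mem_ord hn
  have h := mt (hG.normal (n + 1) _ n hmem hn).2 ((hG.linear (n + 1)).irrefl _)
  simp only [not_forall] at h
  obtain ⟨i, hi, hin⟩ := h
  have := (hG.supp_code _ _ hmem).2 i hi
  obtain rfl := le_antisymm (lt_add_one_iff_le.1 this) (not_lt.1 hin)
  exact hi

variable (S) in
include hS in
omit hG in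
/-- The action on morphisms only depends on their values on the support. -/
theorem IsPraeDilator.map_congr (hG : IsPraeDilator S G) {n m f g σ : M}
    (hf : IsEmb f n (natOrd m)) (hg : IsEmb g n (natOrd m)) (hσ : σ ∈ (G.ord n).carrier)
    (h : ∀ i, i ∈ ext (G.supp n σ) → ap f i = ap g i) : G.map n m f σ = G.map n m g σ := by
  obtain ⟨c, e, he, τ, hτ, rfl⟩ := hG.supp_cond n σ hσ
  obtain ⟨d, hd, hd'⟩ := exists_isEmb_comp S he.1 hf
  rw [← hG.map_comp c n m e f d he.1 hf hd hd' τ hτ,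
    hG.map_comp c n m e g d he.1 hg hd (fun i hi => ?_) τ hτ]
  rw [hd' i hi]
  exact h _ (he.ap_mem hi)

end Dilator

section Derivative

variable [hS : Fact (IsModelRCA0 S)] [hG : Fact (IsNormalPraeDilator S G)]
  [hξ : Fact (IsNatTrans S (comp F G) G ξ)]

variable (S G) in
omit hG in
include hS hξ in
theorem derivBot_mem (n : M) : derivBot ξ n ∈ (G.ord n).carrier := by
  obtain ⟨e, he⟩ := exists_isDElem_bot S (G.ord n)
  exact (hξ.out.incr n).1 _ he.mem

include hS hG hξ in
variable (S G) in
theorem derivPair_mem {n v u : M} (h : (G.ord n).lt u v) :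
    derivPair ξ n v u ∈ (G.ord n).carrier := by
  obtain ⟨e, he, -⟩ := exists_isDElem_pair S (hG.out.linear n) h
  exact (hξ.out.incr n).1 _ he.mem

variable (S) in
include hS hG hξ in
theorem derivPair_lt {n v u v' u' : M} (h : (G.ord n).lt u v) (h' : (G.ord n).lt u' v')
    (hlt : (G.ord n).lt v v' ∨ v = v' ∧ (G.ord n).lt u u') :
    (G.ord n).lt (derivPair ξ n v u) (derivPair ξ n v' u') := by
  obtain ⟨e, he, -⟩ := exists_isDElem_pair S (hG.out.linear n) h
  obtain ⟨e', he', -⟩ := exists_isDElem_pair S (hG.out.linear n) h'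
  have : Fact (IsLinOrd S (G.ord n)) := isLinOrd_ord n
  exact (hξ.out.incr n).2 _ _ he.mem he'.mem (D_F_pair_lt S h h' hlt)

variable (S) in
include hS hG hξ in
theorem derivBot_lt {n v u : M} (h : (G.ord n).lt u v) :
    (G.ord n).lt (derivBot ξ n) (derivPair ξ n v u) := by
  obtain ⟨e, he, -⟩ := exists_isDElem_pair S (hG.out.linear n) h
  obtain ⟨e', he'⟩ := exists_isDElem_bot S (G.ord n)
  have : Fact (IsLinOrd S (G.ord n)) := isLinOrd_ord n
  exact (hξ.out.incr n).2 _ _ he'.mem he.mem (D_F_bot_lt S h)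

variable (S) in
include hS hG hξ in
theorem derivPair_inj {n v u v' u' : M} (h : (G.ord n).lt u v) (h' : (G.ord n).lt u' v')
    (he : derivPair ξ n v u = derivPair ξ n v' u') : v = v' ∧ u = u' := by
  have hl := hG.out.linear n
  have hne : ∀ {v u v' u'}, (G.ord n).lt u v → (G.ord n).lt u' v' →
      derivPair ξ n v u = derivPair ξ n v' u' →
      ¬ ((G.ord n).lt v v' ∨ v = v' ∧ (G.ord n).lt u u') := fun h h' he hlt =>
    hl.irrefl _ (he ▸ derivPair_lt S h h' hlt)
  have h1 := hne h h' he
  have h2 := hne h' h he.symm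
  have hv : v = v' := by
    rcases hl.total v v' (hl.dom _ _ h).2 (hl.dom _ _ h').2 with h | h | h
    · exact absurd (Or.inl h) h1
    · exact h
    · exact absurd (Or.inl h) h2
  refine ⟨hv, ?_⟩
  rcases hl.total u u' (hl.dom _ _ h).1 (hl.dom _ _ h').1 with h | h | h
  · exact absurd (Or.inr ⟨hv, h⟩) h1
  · exact h
  · exact absurd (Or.inr ⟨hv.symm, h⟩) h2

variable (S) in
include hS hG hξ in
theorem map_derivPair {n m f v u : M} (hf : IsEmb f n (natOrd m)) (h : (G.ord n).lt u v) :
    G.map n m f (derivPair ξ n v u) = derivPair ξ m (G.map n m f v) (G.map n m f u) := by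
  obtain ⟨e, he, -⟩ := exists_isDElem_pair S (hG.out.linear n) h
  rw [derivPair, ← hξ.out.natural n m f hf _ he.mem]
  show ξ m (pair (codeOf (G.map n m f '' ext (fst _))) (snd _)) = _
  rw [fst_pair, snd_pair, (codeOf_pair S u v).2, Set.image_pair, derivPair]

variable (S G) in
omit hG in
include hS hξ in
theorem map_derivBot {n m f : M} (hf : IsEmb f n (natOrd m)) :
    G.map n m f (derivBot ξ n) = derivBot ξ m := by
  obtain ⟨e, he⟩ := exists_isDElem_bot S (G.ord n)
  rw [derivBot, ← hξ.out.natural n m f hf _ he.mem]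
  show ξ m (pair (codeOf (G.map n m f '' ext (fst _))) (snd _)) = _
  rw [fst_pair, snd_pair, (codeOf_empty S).2, Set.image_empty, derivBot]

variable (S) in
include hS hG hξ in
/-- Natural transformations do not decrease supports: otherwise two embeddings that differ at
exactly one element of the support would have the same effect on the image. -/
theorem mem_supp_derivPair {n v u i : M} (h : (G.ord n).lt u v)
    (hi : i ∈ ext (G.supp n v) ∨ i ∈ ext (G.supp n u)) :
    i ∈ ext (G.supp n (derivPair ξ n v u)) := by
  have hl := hG.out.linear n
  have hmem := derivPair_mem S G (ξ := ξ) h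
  obtain ⟨f, hf, hf'⟩ := exists_isEmb_skip S n i
  obtain ⟨g, hg, hg'⟩ := exists_isEmb_skip S n (i + 1)
  by_contra hni
  -- `f` omits `i`, `g` omits `i + 1`, and they agree on all arguments but `i`
  have key := hG.out.map_congr S hf hg hmem fun j hj => by
    have hji : j ≠ i := fun h => hni (h ▸ hj)
    have hjn := (hG.out.supp_code n _ hmem).2 j hj
    rw [hf' j hjn, hg' j hjn]
    refine if_congr ?_ rfl rfl
    rw [lt_add_one_iff_le, le_iff_lt_or_eq, or_iff_left hji]
  rw [map_derivPair S hf h, map_derivPair S hg h] at key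
  obtain ⟨hv, hu⟩ := derivPair_inj S ((hG.out.map_incr _ _ _ hf).2 _ _ (hl.dom _ _ h).1
    (hl.dom _ _ h).2 h) ((hG.out.map_incr _ _ _ hg).2 _ _ (hl.dom _ _ h).1 (hl.dom _ _ h).2 h) key
  have hw : ∀ w, w ∈ (G.ord n).carrier → G.map n (n + 1) f w = G.map n (n + 1) g w →
      i ∉ ext (G.supp n w) := by
    intro w hw hfg hiw
    have hmem' : i ∈ ap f '' ext (G.supp n w) := by
      rw [← hG.out.supp_natural _ _ _ hf w hw, hfg, hG.out.supp_natural _ _ _ hg w hw]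
      refine ⟨i, hiw, ?_⟩
      rw [hg' i ((hG.out.supp_code n _ hw).2 i hiw), if_pos (lt_add_one i)]
    obtain ⟨j, hj, hji⟩ := hmem'
    rw [hf' j ((hG.out.supp_code n _ hw).2 j hj)] at hji
    split_ifs at hji with hlt
    · exact hlt.ne hji
    · exact hlt ((lt_add_one j).trans_eq hji)
  rcases hi with hi | hi
  · exact hw v (hl.dom _ _ h).2 hv hi
  · exact hw u (hl.dom _ _ h).1 hu hi

variable (S G ξ) in
/-- `J n ∈ G(n)` is the element that corresponds to the descending sequence `⟨n-1, …, 0⟩` in `n`: it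
is given by the least element of `F(G(0))` for `n = 0`, and by the pair of `n` and the image of
`J n` under the inclusion `incl n` of `n` into `n + 1` for `n + 1`. -/
structure IsDescendingFamily (J incl : M → M) : Prop where
  recursive : Recursive S fun v : Fin 1 → M => J (v 0)
  incl_emb : ∀ n, IsEmb (incl n) n (natOrd (n + 1))
  ap_incl : ∀ n i, i < n → ap (incl n) i = i
  mem : ∀ n, J n ∈ (G.ord n).carrier
  zero : J 0 = derivBot ξ 0
  succ : ∀ n, J (n + 1) =
    derivPair ξ (n + 1) (G.mu (n + 1) n) (G.map n (n + 1) (incl n) (J n))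

variable (S G ξ) in
include hS hG hξ in
theorem exists_isDescendingFamily : ∃ J incl : M → M, IsDescendingFamily S G ξ J incl := by
  choose incl hincl hincl' using fun n : M => exists_isEmb_inclusion S (le_of_lt (lt_add_one n))
  have hlt : ∀ n u, u ∈ (G.ord n).carrier →
      (G.ord (n + 1)).lt (G.map n (n + 1) (incl n) u) (G.mu (n + 1) n) := fun n u hu =>
    hG.out.map_lt_mu (hincl n) hu (lt_add_one n) fun i hi => by rwa [hincl' n i hi]
  have hF : Sigma1 S fun v : Fin 3 → M => v 1 ∈ (G.ord (v 0)).carrier ∧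
      v 2 = derivPair ξ (v 0 + 1) (G.mu (v 0 + 1) (v 0))
        (G.map (v 0) (v 0 + 1) (incl (v 0)) (v 1)) := by
    have : Sigma1 S fun v : Fin 3 → M => ∃ g t s, MapGraph G (v 0) (v 0 + 1) g (v 1) t ∧
        (∀ i, i < v 0 → pair i i ∈ ext g) ∧ MuGraph G (v 0 + 1) (v 0) s ∧
        DerivGraph G ξ (v 0 + 1) (pair (codeOf {t, s}) topPair) (v 2) := inferInstance
    refine this.congr fun v => ⟨?_, ?_⟩
    · rintro ⟨hu, hw⟩
      obtain ⟨e, he, -⟩ := exists_isDElem_pair S (hG.out.linear _) (hlt _ _ hu)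
      refine ⟨incl (v 0), _, _, ⟨hincl _, hu, rfl⟩, fun i hi => ?_, ⟨lt_add_one _, rfl⟩, he.mem, hw⟩
      rw [(hincl _).1.mem_iff]
      exact ⟨hi, (hincl' _ i hi).symm⟩
    · rintro ⟨g, t, s, ⟨hg, hu, rfl⟩, hgi, ⟨-, rfl⟩, -, hw⟩
      have : g = incl (v 0) := hg.1.ext (hincl _).1 fun i hi => by
        rw [hincl' _ i hi]
        exact (hg.1.mem_iff.1 (hgi i hi)).2.symm
      rw [this] at hw
      exact ⟨hu, hw⟩
  obtain ⟨J, hJ, hJ0, hJmem, hJs⟩ := exists_recursion S (derivBot ξ 0)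
    (fun n u => u ∈ (G.ord n).carrier)
    (fun n u => derivPair ξ (n + 1) (G.mu (n + 1) n) (G.map n (n + 1) (incl n) u)) hF
    (derivBot_mem S G 0) fun n u hu => derivPair_mem S G (hlt n u hu)
  exact ⟨J, incl, hJ, hincl, hincl', hJmem, hJ0, hJs⟩

end Derivative

end UpperDerivative

/-! ### Comparing images of descending sequences -/

section Descending

variable {S : Set (Set M)} [IsArith M] {G : DilData M} {ξ : M → M → M}
  [hS : Fact (IsModelRCA0 S)] [hG : Fact (IsNormalPraeDilator S G)]
  [hξ : Fact (IsNatTrans S (comp F G) G ξ)] {J incl : M → M}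

omit hξ hS in
theorem IsDescendingFamily.map_incl_lt_mu (hJ : IsDescendingFamily S G ξ J incl) (n : M) :
    (G.ord (n + 1)).lt (G.map n (n + 1) (incl n) (J n)) (G.mu (n + 1) n) :=
  hG.out.map_lt_mu (hJ.incl_emb n) (hJ.mem n) (lt_add_one n) fun i hi => by
    rwa [hJ.ap_incl n i hi]

include hS hG hξ in
/-- The elements `J n` have full support. -/
theorem IsDescendingFamily.supp_eq (hJ : IsDescendingFamily S G ξ J incl) (n : M) :
    ext (G.supp n (J n)) = {i | i < n} := by
  have hrec : ∀ {k : ℕ} (i : Fin k), Recursive S fun v : Fin k → M => J (v i) := fun i =>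
    hJ.recursive.rename (f := fun v : Fin 1 → M => J (v 0)) fun _ => i
  suffices h : ∃ s, SuppGraph G n (J n) s ∧ ∀ i, i < n → i ∈ ext s by
    obtain ⟨s, ⟨hJn, rfl⟩, h⟩ := h
    exact Set.ext fun i => ⟨(hG.out.supp_code n _ hJn).2 i, h i⟩
  refine sigma_induction S (fun n => ∃ s, SuppGraph G n (J n) s ∧ ∀ i, i < n → i ∈ ext s) ?_ ?_ n
  · exact ⟨_, ⟨hJ.mem 0, rfl⟩, fun i hi => absurd hi not_lt_zero⟩
  · rintro n ⟨s, ⟨hJn, rfl⟩, hs⟩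
    refine ⟨_, ⟨hJ.mem _, rfl⟩, fun i hi => ?_⟩
    rw [hJ.succ]
    refine mem_supp_derivPair S (hJ.map_incl_lt_mu n) ?_
    rcases (lt_add_one_iff_le.1 hi).lt_or_eq with hi | rfl
    · right
      rw [hG.out.supp_natural _ _ _ (hJ.incl_emb n) _ hJn]
      exact ⟨i, hs i hi, hJ.ap_incl n i hi⟩
    · exact Or.inl (hG.out.mem_supp_mu i)

include hS hG hξ in
/-- For an embedding `f : n → c`, the element `y k ∈ G(c)` corresponds to the descending sequence
`⟨f(k-1), …, f(0)⟩` in `c`. These elements can be computed recursively within `G(c)`. -/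
theorem IsDescendingFamily.exists_tower (hJ : IsDescendingFamily S G ξ J incl) {n c f : M}
    (hf : IsEmb f n (natOrd c)) :
    ∃ y : M → M, Sigma1 S (fun v : Fin 2 → M => v 0 ≤ n ∧ v 1 = y (v 0)) ∧ y 0 = derivBot ξ c ∧
      y n = G.map n c f (J n) ∧ ∀ k, k < n → (G.ord c).lt (y k) (G.mu c (ap f k)) ∧
        y (k + 1) = derivPair ξ c (G.mu c (ap f k)) (y k) := by
  have hrec : ∀ {k : ℕ} (i : Fin k), Recursive S fun v : Fin k → M => J (v i) := fun i =>
    hJ.recursive.rename (f := fun v : Fin 1 → M => J (v 0)) fun _ => i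
  have hex : ∀ k, ∃ g, k ≤ n → IsEmb g k (natOrd c) ∧ ∀ i, i < k → ap g i = ap f i := fun k => by
    by_cases hk : k ≤ n
    · obtain ⟨g, hg⟩ := exists_isEmb_restrict S hf hk
      exact ⟨g, fun _ => hg⟩
    · exact ⟨0, fun h => absurd h hk⟩
  choose r hr using hex
  have huniq : ∀ k, k ≤ n → ∀ g, IsEmb g k (natOrd c) → (∀ i, i < k → ap g i = ap f i) → g = r k :=
    fun k hk g hg hgf => hg.1.ext (hr k hk).1.1 fun i hi => by rw [hgf i hi, (hr k hk).2 i hi]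
  refine ⟨fun k => G.map k c (r k) (J k), ?_, ?_, ?_, fun k hk => ⟨?_, ?_⟩⟩
  · have : Sigma1 S fun v : Fin 2 → M => v 0 ≤ n ∧ ∃ g, MapGraph G (v 0) c g (J (v 0)) (v 1) ∧
        ∀ i, i < v 0 → ∃ x, pair i x ∈ ext f ∧ pair i x ∈ ext g := inferInstance
    refine this.congr fun v => and_congr_right fun hv => ⟨fun h => ?_, ?_⟩
    · refine ⟨r (v 0), ⟨(hr _ hv).1, hJ.mem _, h⟩, fun i hi => ?_⟩
      refine ⟨ap f i, hf.1.ap_spec (hi.trans_le hv), ?_⟩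
      rw [← (hr _ hv).2 i hi]
      exact (hr _ hv).1.1.ap_spec hi
    · rintro ⟨g, ⟨hg, -, h⟩, hgf⟩
      rw [h, huniq _ hv g hg fun i hi => ?_]
      obtain ⟨x, hx, hx'⟩ := hgf i hi
      rw [hf.1.mem_iff] at hx
      rw [hg.1.mem_iff] at hx'
      rw [← hx.2, ← hx'.2]
  · show G.map 0 c (r 0) (J 0) = _
    rw [hJ.zero]
    exact map_derivBot S G (hr 0 zero_le).1
  · show G.map n c (r n) (J n) = _
    rw [← huniq n le_rfl f hf fun _ _ => rfl]
  · exact hG.out.map_lt_mu (hr k hk.le).1 (hJ.mem k) (hf.ap_lt hk) fun i hi => by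
      rw [(hr k hk.le).2 i hi]
      exact (hf.lt hi hk).1
  · have hk1 : k + 1 ≤ n := add_one_le_iff_lt.2 hk
    obtain ⟨hr1, hr1'⟩ := hr (k + 1) hk1
    show G.map (k + 1) c (r (k + 1)) (J (k + 1)) = _
    rw [hJ.succ, map_derivPair S hr1 (hJ.map_incl_lt_mu k),
      hG.out.mu_natural _ _ _ hr1 _ (lt_add_one k), hr1' k (lt_add_one k),
      ← hG.out.map_comp k (k + 1) c (incl k) (r (k + 1)) (r k) (hJ.incl_emb k) hr1 (hr k hk.le).1
        (fun i hi => ?_) _ (hJ.mem k)]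
    rw [hJ.ap_incl k i hi, hr1' i (hi.trans (lt_add_one k)), (hr k hk.le).2 i hi]

include hS hG hξ in
/-- Two descending sequences in `c` (given by `f` and `g`) are compared via the first entries at
which they differ: a strict inequality between the corresponding tails is preserved under the
addition of `l` common entries in front. -/
theorem tower_lt {c n m f g : M} {y z : M → M}
    (hys : Sigma1 S fun v : Fin 2 → M => v 0 ≤ n ∧ v 1 = y (v 0))
    (hzs : Sigma1 S fun v : Fin 2 → M => v 0 ≤ m ∧ v 1 = z (v 0))
    (hy : ∀ k, k < n → (G.ord c).lt (y k) (G.mu c (ap f k)) ∧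
      y (k + 1) = derivPair ξ c (G.mu c (ap f k)) (y k))
    (hz : ∀ k, k < m → (G.ord c).lt (z k) (G.mu c (ap g k)) ∧
      z (k + 1) = derivPair ξ c (G.mu c (ap g k)) (z k))
    {a b l : M} (hn : a + l = n) (hm : b + l = m) (h0 : (G.ord c).lt (y a) (z b))
    (hfg : ∀ i, i < l → ap f (a + i) = ap g (b + i)) : (G.ord c).lt (y n) (z m) := by
  have hys' : ∀ {k : ℕ} (i j : Fin k), Sigma1 S fun v : Fin k → M => v i ≤ n ∧ v j = y (v i) :=
    fun i j => hys.rename ![i, j]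
  have hzs' : ∀ {k : ℕ} (i j : Fin k), Sigma1 S fun v : Fin k → M => v i ≤ m ∧ v j = z (v i) :=
    fun i j => hzs.rename ![i, j]
  subst hn hm
  have key := sigma_induction S (fun i => l < i ∨ ∃ a' b' s t, a' = a + i ∧ b' = b + i ∧
    (a' ≤ a + l ∧ s = y a') ∧ (b' ≤ b + l ∧ t = z b') ∧ (G.ord c).lt s t) ?_ ?_ l
  · obtain ⟨_, _, _, _, rfl, rfl, ⟨-, rfl⟩, ⟨-, rfl⟩, h⟩ := key.resolve_left (lt_irrefl l)
    exact h
  · right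
    rw [add_zero, add_zero]
    exact ⟨_, _, _, _, rfl, rfl, ⟨le_self_add, rfl⟩, ⟨le_self_add, rfl⟩, h0⟩
  · intro i hi
    rcases lt_or_ge i l with hil | hil
    swap
    · exact Or.inl (lt_add_one_iff_le.2 hil)
    obtain ⟨_, _, _, _, rfl, rfl, ⟨-, rfl⟩, ⟨-, rfl⟩, h⟩ := hi.resolve_left hil.not_gt
    right
    have hil' : i + 1 ≤ l := add_one_le_iff_lt.2 hil
    refine ⟨_, _, _, _, rfl, rfl, ⟨add_le_add_right hil' a, rfl⟩,
      ⟨add_le_add_right hil' b, rfl⟩, ?_⟩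
    obtain ⟨hy1, hy2⟩ := hy (a + i) (add_lt_add_right hil a)
    obtain ⟨hz1, hz2⟩ := hz (b + i) (add_lt_add_right hil b)
    rw [← add_assoc, ← add_assoc, hy2, hz2]
    exact derivPair_lt S hy1 hz1 (Or.inr ⟨by rw [hfg i hil], h⟩)

end Descending

/-! ### The order `2^A` -/

section TwoPow

variable {S : Set (Set M)}

/-- `s` codes a strictly descending sequence of length `n` in `A`. -/
def IsDescSeq (A : OrdData M) (s n : M) : Prop :=
  IsFun s n A.carrier ∧ ∀ i j, i < j → j < n → A.lt (ap s j) (ap s i)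

variable [IsArith M] [hS : Fact (IsModelRCA0 S)] {A : OrdData M}

instance Delta1.isDescSeq [Fact (IsLinOrd S A)] {k : ℕ} {f g : (Fin k → M) → M}
    [Recursive S f] [Recursive S g] : Delta1 S fun v => IsDescSeq A (f v) (g v) := by
  have : Delta1 S fun v => IsFun (f v) (g v) A.carrier ∧ ∀ i, i < f v → ∀ j, j < f v →
      ∀ x, x < f v → ∀ y, y < f v → pair i x ∈ ext (f v) → pair j y ∈ ext (f v) → i < j →
        A.lt y x := inferInstance
  refine this.congr fun v => and_congr_right fun hf => ⟨fun h => ?_, fun h i j hij hj => ?_⟩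
  · intro i _ j _ x _ y _ hx hy hij
    rw [hf.mem_iff] at hx hy
    rw [hx.2, hy.2]
    exact h i j hij hy.1
  · have hi := hij.trans hj
    have hx := hf.ap_spec hi
    have hy := hf.ap_spec hj
    exact h i (lt_left_of_pair_mem_ext hx) j (lt_left_of_pair_mem_ext hy) _
      (lt_right_of_pair_mem_ext hx) _ (lt_right_of_pair_mem_ext hy) hx hy hij

variable (S) in
include hS in
theorem twoPow_total (hA : A.IsLinear) {s t n m : M} (hs : IsDescSeq A s n)
    (ht : IsDescSeq A t m) : (twoPow A).lt s t ∨ s = t ∨ (twoPow A).lt t s := by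
  -- the first position at which the sequences differ or one of them ends
  obtain ⟨k, hk, hmin⟩ := exists_least S (fun k => n ≤ k ∨ m ≤ k ∨
    ¬ ∃ x, x < s ∧ pair k x ∈ ext s ∧ pair k x ∈ ext t) ⟨n, Or.inl le_rfl⟩
  have heq : ∀ i, i < k → ap s i = ap t i := fun i hi => by
    have := hmin i hi
    push Not at this
    obtain ⟨-, -, x, -, hx, hx'⟩ := this
    rw [hs.1.mem_iff] at hx
    rw [ht.1.mem_iff] at hx'
    rw [← hx.2, ← hx'.2]
  have hkn : k ≤ n := not_lt.1 fun h => hmin n h (Or.inl le_rfl)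
  have hkm : k ≤ m := not_lt.1 fun h => hmin m h (Or.inr (Or.inl le_rfl))
  rcases hkn.lt_or_eq with hn | rfl
  · rcases hkm.lt_or_eq with hm | rfl
    · rcases hA.total _ _ (hs.1.ap_mem hn) (ht.1.ap_mem hm) with h | h | h
      · exact Or.inl ⟨n, m, hs, ht, Or.inr ⟨k, hn, hm, h, heq⟩⟩
      · rcases hk with hk | hk | hk
        · exact absurd hn hk.not_gt
        · exact absurd hm hk.not_gt
        · exact absurd ⟨_, hs.1.ap_lt hn, hs.1.ap_spec hn, h ▸ ht.1.ap_spec hm⟩ hk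
      · exact Or.inr (Or.inr ⟨m, n, ht, hs, Or.inr ⟨k, hm, hn, h, fun i hi => (heq i hi).symm⟩⟩)
    · exact Or.inr (Or.inr ⟨k, n, ht, hs, Or.inl ⟨hn, fun i hi => (heq i hi).symm⟩⟩)
  · rcases hkm.lt_or_eq with hm | rfl
    · exact Or.inl ⟨k, m, hs, ht, Or.inl ⟨hm, heq⟩⟩
    · exact Or.inr (Or.inl (hs.1.ext ht.1 heq))

/-- The code of the set of entries of the finite sequence `s`. -/
noncomputable def entries (s : M) : M := codeOf {x | ∃ i, i < s ∧ pair i x ∈ ext s}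

variable (S) in
include hS in
theorem entries_spec (s : M) :
    IsFinCode (entries s) ∧ ext (entries s) = {x | ∃ i, i < s ∧ pair i x ∈ ext s} :=
  codeOf_setOf S (fun x => ∃ i, i < s ∧ pair i x ∈ ext s) s fun _ ⟨_, _, h⟩ =>
    lt_right_of_pair_mem_ext h

variable (S) in
include hS in
/-- The increasing enumeration of the entries of a descending sequence reverses the sequence. -/
theorem IsDescSeq.exists_isEnum {s n : M} (hs : IsDescSeq A s n) :
    ∃ e, IsEnum A e n (entries s) ∧ ∀ i j, i + j + 1 = n → ap e i = ap s j := by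
  obtain ⟨e, he, heR⟩ := exists_isFun_of_rel S n
    (fun i x => ∃ j, i + j + 1 = n ∧ pair j x ∈ ext s) (B := A.carrier) (by
      intro i hi
      obtain ⟨j, hj⟩ := exists_add_of_le (add_one_le_iff_lt.2 hi)
      have hj' : i + j + 1 = n := by rw [hj]; ring
      have hjn : j < n := by rw [← hj', lt_add_one_iff_le]; exact le_add_self
      refine ⟨_, hs.1.ap_mem hjn, fun x => ?_⟩
      simp only [hs.1.mem_iff]
      constructor
      · rintro ⟨k, hk, -, hx⟩
        rw [← hj', add_left_inj, add_right_inj] at hk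
        rwa [← hk]
      · exact fun hx => ⟨j, hj', hjn, hx⟩)
  have hap : ∀ i j, i + j + 1 = n → ap e i = ap s j := fun i j hij => by
    have hi : i < n := by rw [← hij, lt_add_one_iff_le]; exact le_self_add
    have hj : j < n := by rw [← hij, lt_add_one_iff_le]; exact le_add_self
    exact ((heR i hi _).1 ⟨j, hij, hs.1.ap_spec hj⟩).symm
  have hrev : ∀ i, i < n → ∃ j, i + j + 1 = n := fun i hi => by
    obtain ⟨j, hj⟩ := exists_add_of_le (add_one_le_iff_lt.2 hi)
    exact ⟨j, by rw [hj]; ring⟩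
  refine ⟨e, ⟨isEmb_iff_ap.2 ⟨he, fun i j hij hj => ?_⟩, fun x => ?_⟩, hap⟩
  · obtain ⟨i', hi'⟩ := hrev i (hij.trans hj)
    obtain ⟨j', hj'⟩ := hrev j hj
    rw [hap _ _ hi', hap _ _ hj']
    refine hs.2 j' i' ?_ (by rw [← hi', lt_add_one_iff_le]; exact le_add_self)
    have h := hi'.trans hj'.symm
    rw [add_left_inj] at h
    by_contra hlt
    exact absurd h (add_lt_add_of_lt_of_le hij (not_lt.1 hlt)).ne
  · rw [(entries_spec S s).2]
    simp only [Set.mem_ofPred_eq, hs.1.mem_iff, he.mem_iff]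
    constructor
    · rintro ⟨j, -, hj, rfl⟩
      obtain ⟨i, hi⟩ := hrev j hj
      rw [add_comm j i] at hi
      exact ⟨i, by rw [← hi, lt_add_one_iff_le]; exact le_self_add, (hap i j hi).symm⟩
    · rintro ⟨i, hi, rfl⟩
      obtain ⟨j, hj⟩ := hrev i hi
      have hjn : j < n := by rw [← hj, lt_add_one_iff_le]; exact le_add_self
      exact ⟨j, hjn.trans_le hs.1.length_le, hjn, hap i j hj⟩

end TwoPow

/-! ### The embedding of `2^X` -/

section Embedding

variable {S : Set (Set M)} [IsArith M] {G : DilData M} {ξ : M → M → M}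
  [hS : Fact (IsModelRCA0 S)] [hG : Fact (IsNormalPraeDilator S G)]
  [hξ : Fact (IsNatTrans S (comp F G) G ξ)] {J incl : M → M} {X : OrdData M}
  [hX : Fact (IsLinOrd S X)]

variable (J X) in
/-- The descending sequence `s` of length `n` is sent to `⟨a, J n⟩`, where `a` is the set of its
entries. -/
noncomputable def twoPowEmb (s : M) : M :=
  pair (entries s) (J (pick fun n => IsDescSeq X s n))

theorem twoPowEmb_eq {s n : M} (hs : IsDescSeq X s n) :
    twoPowEmb J X s = pair (entries s) (J n) := by
  rw [twoPowEmb, pick_eq hs fun m hm => hm.1.length_unique hs.1]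

omit hX in
include hS hG hξ in
theorem IsDescendingFamily.isDElem (hJ : IsDescendingFamily S G ξ J incl) {s n e : M}
    (hs : IsDescSeq X s n) (he : IsEnum X e n (entries s)) :
    IsDElem G X (twoPowEmb J X s) (entries s) (J n) n e := by
  refine ⟨twoPowEmb_eq hs, (entries_spec S s).1, ?_, he, hJ.mem n, hJ.supp_eq n⟩
  intro x hx
  obtain ⟨i, hi, rfl⟩ := he.mem_iff.1 hx
  exact he.1.ap_mem hi

include hS hG hξ hX in
theorem IsDescendingFamily.twoPowEmb_lt (hJ : IsDescendingFamily S G ξ J incl) {s t : M}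
    (h : (twoPow X).lt s t) : (D G X).lt (twoPowEmb J X s) (twoPowEmb J X t) := by
  obtain ⟨n, m, hs, ht, h⟩ := h
  have hl := hX.out.linear
  obtain ⟨e₀, he₀, hap₀⟩ := IsDescSeq.exists_isEnum S hs
  obtain ⟨e₁, he₁, hap₁⟩ := IsDescSeq.exists_isEnum S ht
  refine (hJ.isDElem hs he₀).lt S (hJ.isDElem ht he₁) fun c e f₀ f₁ he hf₀ h₀ hf₁ h₁ => ?_
  obtain ⟨y, hys, hy0, hyn, hy⟩ := hJ.exists_tower hf₀
  obtain ⟨z, hzs, -, hzm, hz⟩ := hJ.exists_tower hf₁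
  rw [← hyn, ← hzm]
  have hlt_left : ∀ {i j k : M}, i + j + 1 = k → i < k := fun h => by
    rw [← h, lt_add_one_iff_le]; exact le_self_add
  -- entries of `s` and `t` are compared via the corresponding values of `f₀` and `f₁`
  have heq : ∀ {i i' j}, i + j + 1 = n → i' + j + 1 = m → ap s j = ap t j → ap f₀ i = ap f₁ i' := by
    intro i i' j hi hi' hst
    refine he.injective hl (hf₀.ap_lt (hlt_left hi)) (hf₁.ap_lt (hlt_left hi')) ?_
    rw [h₀ i (hlt_left hi), h₁ i' (hlt_left hi'), hap₀ i j hi, hap₁ i' j hi', hst]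
  rcases h with ⟨hnm, hst⟩ | ⟨k, hkn, hkm, hlt, hst⟩
  · obtain ⟨d, rfl⟩ := exists_add_of_le (add_one_le_iff_lt.2 hnm)
    refine tower_lt hys hzs hy hz (a := 0) (b := d + 1) (zero_add n) (by ring) ?_ fun i hi => ?_
    · obtain ⟨hz1, hz2⟩ := hz d (lt_of_lt_of_le (lt_add_one d) (by
        rw [add_assoc, add_comm 1 d]; exact le_add_self))
      rw [hy0, hz2]
      exact derivBot_lt S hz1
    · obtain ⟨j, hj⟩ := exists_add_of_le (add_one_le_iff_lt.2 hi)
      have hj' : j < n := hlt_left (i := j) (j := i) (by rw [hj]; ring)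
      exact heq (j := j) (by rw [hj]; ring) (by rw [hj]; ring) (hst j hj')
  · obtain ⟨a, ha⟩ := exists_add_of_le (add_one_le_iff_lt.2 hkn)
    obtain ⟨b, hb⟩ := exists_add_of_le (add_one_le_iff_lt.2 hkm)
    have ha' : a + k + 1 = n := by rw [ha]; ring
    have hb' : b + k + 1 = m := by rw [hb]; ring
    refine tower_lt hys hzs hy hz (a := a + 1) (b := b + 1) (l := k) (by rw [ha]; ring)
      (by rw [hb]; ring) ?_ fun i hi => ?_
    · obtain ⟨hy1, hy2⟩ := hy a (hlt_left ha')
      obtain ⟨hz1, hz2⟩ := hz b (hlt_left hb')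
      rw [hy2, hz2]
      refine derivPair_lt S hy1 hz1 (Or.inl ((hG.out.mu_incr c).2 _ _ (hf₀.ap_lt (hlt_left ha'))
        (hf₁.ap_lt (hlt_left hb')) ⟨?_, hf₁.ap_lt (hlt_left hb')⟩))
      rw [← he.lt_iff hl (hf₀.ap_lt (hlt_left ha')) (hf₁.ap_lt (hlt_left hb')),
        h₀ a (hlt_left ha'), h₁ b (hlt_left hb'), hap₀ a k ha', hap₁ b k hb']
      exact hlt
    · obtain ⟨j, hj⟩ := exists_add_of_le (add_one_le_iff_lt.2 hi)
      have hj' : j < k := hlt_left (i := j) (j := i) (by rw [hj]; ring)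
      exact heq (j := j) (by rw [ha, hj]; ring) (by rw [hb, hj]; ring) (hst j hj')

include hS hG hξ hX in
theorem IsDescendingFamily.isOrderEmbedding (hJ : IsDescendingFamily S G ξ J incl) :
    IsOrderEmbedding S (twoPow X) (D G X) (twoPowEmb J X) := by
  refine ⟨?_, ?_, ?_⟩
  · have hrec : ∀ {k : ℕ} (i : Fin k), Recursive S fun v : Fin k → M => J (v i) := fun i =>
      hJ.recursive.rename (f := fun v : Fin 1 → M => J (v 0)) fun _ => i
    have := comprehension S fun p => ∃ s, s < p + 1 ∧ ∃ a, a < p + 1 ∧ ∃ n, n < s + 1 ∧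
      p = pair s (pair a (J n)) ∧ IsDescSeq X s n ∧ IsFinCode a ∧
        ∀ x, x < a + s → (x ∈ ext a ↔ ∃ i, i < s ∧ pair i x ∈ ext s)
    convert this using 3 with p
    have hent : ∀ s, ext (entries s) = {x | ∃ i, i < s ∧ pair i x ∈ ext s} := fun s =>
      (entries_spec S s).2
    constructor
    · rintro ⟨s, ⟨n, hs⟩, rfl⟩
      rw [twoPowEmb_eq hs]
      refine ⟨s, lt_add_one_iff_le.2 (le_pair_left _ _), entries s, lt_add_one_iff_le.2 ?_, n,
        lt_add_one_iff_le.2 hs.1.length_le, rfl, hs, (entries_spec S s).1, fun x _ => ?_⟩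
      · exact (le_pair_left _ _).trans (le_pair_right _ _)
      · rw [hent]; rfl
    · rintro ⟨s, -, a, -, n, -, rfl, hs, ha, hax⟩
      refine ⟨s, ⟨n, hs⟩, ?_⟩
      rw [twoPowEmb_eq hs, ha.ext_inj (entries_spec S s).1]
      rw [hent]
      ext x
      refine ⟨fun hx => (hax x ((lt_of_mem_ext hx).trans_le le_self_add)).1 hx, fun hx => ?_⟩
      obtain ⟨i, hi, hix⟩ := hx
      exact (hax x ((lt_right_of_pair_mem_ext hix).trans_le le_add_self)).2 ⟨i, hi, hix⟩
  · rintro s ⟨n, hs⟩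
    obtain ⟨e, he, -⟩ := IsDescSeq.exists_isEnum S hs
    exact (hJ.isDElem hs he).mem
  · rintro s t ⟨n, hs⟩ ⟨m, ht⟩
    refine ⟨hJ.twoPowEmb_lt, fun h => ?_⟩
    have hasymm := fun {p q} => D_asymm S hG.out.linear hX.out.linear (p := p) (q := q)
    rcases twoPow_total S hX.out.linear hs ht with h' | rfl | h'
    · exact h'
    · exact absurd h (hasymm h)
    · exact absurd h (hasymm (hJ.twoPowEmb_lt h'))

end Embedding

end SOA

theorem theorem3p2 {M : Type u} [SOA.ArithStr M] (S : Set (Set M)) (hS : SOA.IsModelRCA0 S)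
    (G : SOA.DilData M) (ξ : M → M → M) (hG : SOA.IsUpperDerivative S SOA.F G ξ)
    (X : SOA.OrdData M) (hX : SOA.IsLinOrd S X) :
    ∃ J : M → M, SOA.IsOrderEmbedding S (SOA.twoPow X) (SOA.D G X) J := by
  have := hS.isArith
  have := Fact.mk hS
  have := Fact.mk hG.normal
  have := Fact.mk hG.natTrans
  have := Fact.mk hX
  obtain ⟨J, incl, hJ⟩ := SOA.exists_isDescendingFamily S G ξ
  exact ⟨_, hJ.isOrderEmbedding⟩
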